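/- **Theorem (Minkowski-type formula).** Let $n\ge 1$ and let $\gamma:S^n\to\mathbb R_{>0}$ be of class $C^2$ on the unit sphere $S^n\subset\mathbb R^{n+1}$. Let $\xi=\xi_\gamma:S^n\to\mathbb R^{n+1}$, $\xi(\nu)=D\gamma|_\nu+\gamma(\nu)\,\nu$, be its Cahn–Hoffman map, where $D\gamma$ is the gradient of $\gamma$ on $S^n$ and $T_\nu S^n$ is regarded as the subspace $\nu^\perp$ of $\mathbb R^{n+1}$. Let $M=\bigcup_{i=1}^k M_i$ be an $n$-dimensional oriented, compact, connected $C^\infty$ manifold without boundary, where each $M_i$ is an $n$-dimensional connected compact submanifold of $M$ with piecewise-$C^\infty$ boundary, and $M_i\cap M_j=\partial M_i\cap\partial M_j$ for $i\neq j$. Let $X:M\to\mathbb R^{n+1}$ be a (closed) piecewise-$C^2$ weak immersion, that is: 1. $X$ is continuous and each $X|_{M_i}$ is of class $C^2$ on $M_i$; 2. $X$ is an immersion on the interior $M_i^o$ of each $M_i$; 3. the unit normal $\nu_i:M_i^o\to S^n$ of $X|_{M_i^o}$ extends to a $C^1$ map $\nu_i:M_i\to S^n$; here $\nu_i$ is chosen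 so that $(\nu_i,\partial X/\partial u^1,\dots,\partial X/\partial u^n)$ is a positively oriented basis of $\mathbb R^{n+1}$ for every positively oriented local coordinate system $(u^1,\dots,u^n)$ of $M$. Write $\nu=\nu_i$ and $\tilde\xi_i=\xi\circ\nu_i$ on $M_i$, let $dA$ be the $n$-dimensional volume measure on $M$ induced by $X$, and let $\int_M$ mean $\sum_{i=1}^k\int_{M_i}$. At a point of $M_i^o$ let $S^\gamma=-d\tilde\xi_i:T_pM\to T_pM$ be the anisotropic shape operator ($T_pM$ being identified with $dX(T_pM)=\nu_i(p)^\perp$ by $dX_p$), let $k^\gamma_1,\dots,k^\gamma_n\in\mathbb C$ be its eigenvalues with multiplicity, and let $$H^\gamma_r=\binom nr^{-1}\sum_{1\le l_1<\cdots<l_r\le n}k^\gamma_{l_1}\cdots k^\gamma_{l_r}\quad(0\le r\le n),\qquad H^\gamma_0=1,\qquad \Lambda=H^\gamma_1$$ be the (real) $r$-th anisotropic mean curvature and the anisotropic mean curvature. Assume that $H^\gamma_r$ is integrable on $M$ with respect to $dA$ for $r=1,\dots,n$, and that $$\tilde\xi_i(\zeta)=\tilde\xi_j(\zeta)\qquad\text{for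 all }\zeta\in\partial M_i\cap\partial M_j\text{ and all }i,j .$$ Then, for every $r=0,\dots,n-1$, the function $\gamma(\nu)H^\gamma_r+\langle X,\nu\rangle H^\gamma_{r+1}$ is integrable and $$\int_M\bigl(\gamma(\nu)\,H^\gamma_r+\langle X,\nu\rangle\,H^\gamma_{r+1}\bigr)\,dA=0 .$$ In particular, for $r=0$, $$\int_M\bigl(\gamma(\nu)+\Lambda\,\langle X,\nu\rangle\bigr)\,dA=0 .$$ -/

import Mathlib

open scoped Manifold ContDiff
open MeasureTheory Set

/-- The Euclidean space `ℝᵈ`. -/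
abbrev Euc (d : ℕ) : Type := EuclideanSpace ℝ (Fin d)

/-- The unit sphere `Sⁿ ⊂ ℝⁿ⁺¹`. -/
abbrev USphere (n : ℕ) : Type := Metric.sphere (0 : Euc (n + 1)) 1

/-! ### The Cahn–Hoffman map -/

section CahnHoffman

variable {n : ℕ}

/-- The extension of `γ : Sⁿ → ℝ` to `ℝⁿ⁺¹ ∖ {0}` which is constant along rays from the origin. -/
noncomputable def radialExtension (γ : USphere n → ℝ) (x : Euc (n + 1)) : ℝ :=
  Function.extend (Subtype.val : USphere n → Euc (n + 1)) γ 0 (‖x‖⁻¹ • x)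

/-- The gradient `Dγ` of `γ` on `Sⁿ`, as a vector of `ℝⁿ⁺¹`: the Euclidean gradient at `ν` of the
extension of `γ` that is constant along rays.  `inner_sphereGradient_self` and
`inner_sphereGradient_mfderiv_coe` below show that it is the Riemannian gradient of `γ`, i.e. the
vector of `T_ν Sⁿ = ν^⊥` which represents `dγ`. -/
noncomputable def sphereGradient (γ : USphere n → ℝ) (ν : USphere n) : Euc (n + 1) :=
  gradient (radialExtension γ) (ν : Euc (n + 1))

/-- The Cahn–Hoffman map `ξ(ν) = Dγ|_ν + γ(ν) ν`. -/
noncomputable def cahnHoffman (γ : USphere n → ℝ) (ν : USphere n) : Euc (n + 1) :=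
  sphereGradient γ ν + γ ν • (ν : Euc (n + 1))

/-- On the sphere, the radial extension of `γ` is `γ`. -/
theorem radialExtension_coe (γ : USphere n → ℝ) (ν : USphere n) :
    radialExtension γ (ν : Euc (n + 1)) = γ ν := by
  have h : ‖(ν : Euc (n + 1))‖ = 1 := norm_eq_of_mem_sphere ν
  simp only [radialExtension, h, inv_one, one_smul]
  exact Subtype.val_injective.extend_apply γ 0 ν

theorem differentiableAt_radialExtension {γ : USphere n → ℝ}
    (hγ : ContMDiff (𝓡 n) 𝓘(ℝ, ℝ) 1 γ) (ν : USphere n) :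
    DifferentiableAt ℝ (radialExtension γ) (ν : Euc (n + 1)) := by
  have := Fact.mk (@finrank_euclideanSpace_fin ℝ _ (n + 1))
  let U : TopologicalSpace.Opens (Euc (n + 1)) := ⟨{x | x ≠ 0}, isOpen_ne⟩
  have hν : (ν : Euc (n + 1)) ≠ 0 := ne_zero_of_mem_unit_sphere ν
  let f : U → Euc (n + 1) := fun x => ‖(x : Euc (n + 1))‖⁻¹ • (x : Euc (n + 1))
  have hf : ContMDiff 𝓘(ℝ, Euc (n + 1)) 𝓘(ℝ, Euc (n + 1)) 1 f := by
    intro x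
    refine (contMDiffAt_subtype_iff (U := U)
      (f := fun x : Euc (n + 1) => ‖x‖⁻¹ • x)).2 (ContDiffAt.contMDiffAt ?_)
    have hx : (x : Euc (n + 1)) ≠ 0 := x.2
    exact ((contDiffAt_norm ℝ hx).inv (norm_ne_zero_iff.2 hx)).smul contDiffAt_id
  have hf' : ∀ x, f x ∈ Metric.sphere (0 : Euc (n + 1)) 1 := by
    intro x
    have hx : (x : Euc (n + 1)) ≠ 0 := x.2
    simp [f, norm_smul, inv_mul_cancel₀ (norm_ne_zero_iff.2 hx)]
  have hN := hγ.comp (hf.codRestrict_sphere (n := n) hf')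
  have key : ContMDiffAt 𝓘(ℝ, Euc (n + 1)) 𝓘(ℝ, ℝ) 1 (radialExtension γ) (ν : Euc (n + 1)) := by
    refine (contMDiffAt_subtype_iff (U := U) (f := radialExtension γ) (x := ⟨ν, hν⟩)).1 ?_
    convert! hN.contMDiffAt using 1
    ext x
    exact Subtype.val_injective.extend_apply γ 0 ⟨f x, hf' x⟩
  exact key.contDiffAt.differentiableAt one_ne_zero

theorem inner_sphereGradient_self {γ : USphere n → ℝ}
    (hγ : ContMDiff (𝓡 n) 𝓘(ℝ, ℝ) 1 γ) (ν : USphere n) :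
    inner ℝ (sphereGradient γ ν) (ν : Euc (n + 1)) = 0 := by
  have hd := differentiableAt_radialExtension hγ ν
  have hc : HasDerivAt (fun t : ℝ => (1 + t) • (ν : Euc (n + 1))) (ν : Euc (n + 1)) 0 := by
    simpa using ((hasDerivAt_id (0 : ℝ)).const_add 1).smul_const (ν : Euc (n + 1))
  have h1 : HasDerivAt (fun t : ℝ => radialExtension γ ((1 + t) • (ν : Euc (n + 1))))
      (fderiv ℝ (radialExtension γ) (ν : Euc (n + 1)) ν) 0 := by
    have hd' : HasFDerivAt (radialExtension γ) (fderiv ℝ (radialExtension γ) (ν : Euc (n + 1)))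
        ((1 + (0 : ℝ)) • (ν : Euc (n + 1))) := by
      rw [add_zero, one_smul]
      exact hd.hasFDerivAt
    exact hd'.comp_hasDerivAt (f := fun t : ℝ => (1 + t) • (ν : Euc (n + 1))) (0 : ℝ) hc
  have h2 : (fun t : ℝ => radialExtension γ ((1 + t) • (ν : Euc (n + 1)))) =ᶠ[nhds 0]
      fun _ => γ ν := by
    filter_upwards [Ioi_mem_nhds (show (-1 : ℝ) < 0 by norm_num)] with t ht
    have ht' : (0 : ℝ) < 1 + t := by linarith [mem_Ioi.1 ht]
    have hn : ‖(ν : Euc (n + 1))‖ = 1 := norm_eq_of_mem_sphere ν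
    rw [← radialExtension_coe γ ν]
    simp only [radialExtension, norm_smul, hn, Real.norm_eq_abs, abs_of_pos ht', mul_one, inv_one,
      smul_smul, inv_mul_cancel₀ ht'.ne']
  have h3 := h1.unique ((hasDerivAt_const (0 : ℝ) (γ ν)).congr_of_eventuallyEq h2)
  rw [sphereGradient, gradient, InnerProductSpace.toDual_symm_apply]
  exact h3

theorem inner_sphereGradient_mfderiv_coe {γ : USphere n → ℝ}
    (hγ : ContMDiff (𝓡 n) 𝓘(ℝ, ℝ) 1 γ) (ν : USphere n) (v : TangentSpace (𝓡 n) ν) :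
    inner ℝ (sphereGradient γ ν)
      (mfderiv (𝓡 n) 𝓘(ℝ, Euc (n + 1)) (fun w : USphere n => (w : Euc (n + 1))) ν v :
        Euc (n + 1)) = (mfderiv (𝓡 n) 𝓘(ℝ, ℝ) γ ν v : ℝ) := by
  have := Fact.mk (@finrank_euclideanSpace_fin ℝ _ (n + 1))
  have hd := differentiableAt_radialExtension hγ ν
  have hcoe : MDifferentiableAt (𝓡 n) 𝓘(ℝ, Euc (n + 1))
      (fun w : USphere n => (w : Euc (n + 1))) ν :=
    (contMDiff_coe_sphere (m := 1)).contMDiffAt.mdifferentiableAt one_ne_zero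
  have h : γ = radialExtension γ ∘ fun w : USphere n => (w : Euc (n + 1)) :=
    funext fun w => (radialExtension_coe γ w).symm
  have h2 := mfderiv_comp ν (g := radialExtension γ) hd.mdifferentiableAt hcoe
  rw [mfderiv_eq_fderiv] at h2
  have hg : ∀ w : Euc (n + 1), inner ℝ (sphereGradient γ ν) w =
      fderiv ℝ (radialExtension γ) (ν : Euc (n + 1)) w := fun w => by
    rw [sphereGradient, gradient, InnerProductSpace.toDual_symm_apply]
  refine (hg _).trans ?_
  have h3 : mfderiv (𝓡 n) 𝓘(ℝ, ℝ) γ ν = mfderiv (𝓡 n) 𝓘(ℝ, ℝ)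
      (radialExtension γ ∘ fun w : USphere n => (w : Euc (n + 1))) ν := by rw [← h]
  rw [h3, h2]
  rfl

end CahnHoffman

/-! ### Piecewise smooth decompositions -/

section Pieces

variable (n : ℕ) {M : Type*} [TopologicalSpace M] [ChartedSpace (Euc n) M]

/-- The charts of the atlas of `M` orient `M`: all coordinate changes have positive Jacobian. -/
def IsOrientedAtlas (M : Type*) [TopologicalSpace M] [ChartedSpace (Euc n) M] : Prop :=
  ∀ e ∈ atlas (Euc n) M, ∀ e' ∈ atlas (Euc n) M, ∀ u ∈ (e.symm.trans e').source,
    0 < (fderiv ℝ (e.symm.trans e') u).det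

/-- A compact piece `F` of an embedded smooth hypersurface of `M`: a compact set on which a smooth
function, defined near `F`, vanishes while its differential does not. -/
def IsSmoothFace (F : Set M) : Prop :=
  IsCompact F ∧ ∃ (U : Set M) (h : M → ℝ), IsOpen U ∧ F ⊆ U ∧ ContMDiffOn (𝓡 n) 𝓘(ℝ, ℝ) ∞ h U ∧
    ∀ p ∈ F, h p = 0 ∧ mfderiv (𝓡 n) 𝓘(ℝ, ℝ) h p ≠ 0

/-- `K` is an `n`-dimensional compact connected submanifold of the `n`-manifold `M` with
piecewise-`C^∞` boundary.  Since `dim K = dim M`, the interior and the boundary of `K` as a manifold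
are its topological interior and frontier in `M`. -/
structure IsPiecewiseSmoothDomain (K : Set M) : Prop where
  isCompact : IsCompact K
  isConnected : IsConnected K
  /-- Near a boundary point, `K` is a topological half-space. -/
  halfSpace : ∀ p ∈ frontier K, ∃ (φ : OpenPartialHomeomorph M (Euc n)) (l : Euc n →L[ℝ] ℝ),
    p ∈ φ.source ∧ l ≠ 0 ∧ l (φ p) = 0 ∧ ∀ q ∈ φ.source, q ∈ K ↔ 0 ≤ l (φ q)
  /-- The boundary is a finite union of compact pieces of smooth hypersurfaces. -/
  faces : ∃ 𝓕 : Set (Set M), 𝓕.Finite ∧ (∀ F ∈ 𝓕, IsSmoothFace n F) ∧ frontier K = ⋃₀ 𝓕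

/-- `M = ⋃ᵢ Mᵢ`, where each `Mᵢ` is an `n`-dimensional connected compact submanifold with
piecewise-`C^∞` boundary and `Mᵢ ∩ Mⱼ = ∂Mᵢ ∩ ∂Mⱼ` for `i ≠ j`. -/
structure IsPiecewiseDecomposition {k : ℕ} (P : Fin k → Set M) : Prop where
  domain : ∀ i, IsPiecewiseSmoothDomain n (P i)
  cover : ⋃ i, P i = univ
  inter : ∀ i j, i ≠ j → P i ∩ P j = frontier (P i) ∩ frontier (P j)

end Pieces

/-! ### Weak immersions, induced volume and anisotropic curvatures -/

section Hypersurface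

variable {n : ℕ} {M : Type*} [TopologicalSpace M] [ChartedSpace (Euc n) M]

/-- The differential at `p` of a map `f : M → ℝⁿ⁺¹`. -/
noncomputable def diffAt (f : M → Euc (n + 1)) (p : M) :
    TangentSpace (𝓡 n) p →L[ℝ] Euc (n + 1) :=
  mfderiv (𝓡 n) 𝓘(ℝ, Euc (n + 1)) f p

/-- The coordinate derivative `∂X/∂uⁱ` with respect to the chart `e`, at the point of `M` with
coordinates `u`. -/
noncomputable def chartPartial (X : M → Euc (n + 1)) (e : OpenPartialHomeomorph M (Euc n))
    (u : Euc n) (i : Fin n) : Euc (n + 1) :=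
  fderiv ℝ (X ∘ e.symm) u (EuclideanSpace.single i 1)

/-- `X : M = ⋃ᵢ Mᵢ → ℝⁿ⁺¹` is a piecewise-`C^r` weak immersion (`r ≥ 1`), and `ν i : Mᵢ → Sⁿ` is the
extension to `Mᵢ` of its unit normal on the interior of `Mᵢ`.  (Only the values of `ν i` on `Mᵢ`
matter.)  The charts of the atlas are positively oriented coordinate systems of `M`. -/
structure IsPiecewiseWeakImmersion (r : ℕ) {k : ℕ} (P : Fin k → Set M) (X : M → Euc (n + 1))
    (ν : Fin k → M → USphere n) : Prop where
  continuous : Continuous X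
  contMDiffOn : ∀ i, ContMDiffOn (𝓡 n) 𝓘(ℝ, Euc (n + 1)) r X (P i)
  immersion : ∀ i, ∀ p ∈ interior (P i), Function.Injective (diffAt X p)
  normal : ∀ i, ∀ p ∈ interior (P i), ∀ v, inner ℝ (ν i p : Euc (n + 1)) (diffAt X p v) = 0
  normal_contMDiffOn : ∀ i, ContMDiffOn (𝓡 n) (𝓡 n) ((r - 1 : ℕ) : WithTop ℕ∞) (ν i) (P i)
  /-- `ν, ∂X/∂u¹, …, ∂X/∂uⁿ` is a positively oriented basis of `ℝⁿ⁺¹`. -/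
  orientation : ∀ i, ∀ p ∈ interior (P i), ∀ e ∈ atlas (Euc n) M, p ∈ e.source →
    0 < (EuclideanSpace.basisFun (Fin (n + 1)) ℝ).toBasis.det
      (Fin.cons (ν i p : Euc (n + 1)) (chartPartial X e (e p)))

/-- The volume density `√det(⟨∂X/∂uⁱ, ∂X/∂uʲ⟩)` of the metric induced by `X`, in the chart `e`.  At
the points where `X` is not an immersion (in particular where it is not differentiable) it is `0`
as soon as `n ≥ 1`. -/
noncomputable def volumeDensity (X : M → Euc (n + 1)) (e : OpenPartialHomeomorph M (Euc n))
    (u : Euc n) : ℝ :=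
  √(Matrix.gram ℝ (chartPartial X e u)).det

/-- The measure `√det(g) du¹ ⋯ duⁿ` on the domain of the chart `e` (extended by `0` to `M`). -/
noncomputable def chartVolume [MeasurableSpace M] (X : M → Euc (n + 1))
    (e : OpenPartialHomeomorph M (Euc n)) : Measure M :=
  ((volume.restrict e.target).withDensity
    fun u => ENNReal.ofReal (volumeDensity X e u)).map e.symm

/-- The volume measure `dA` of `M` induced by `X`.  The measures `chartVolume X e` agree on the
overlaps of the charts `e` (`chartVolume_overlap`), so their supremum is the measure that is given by
`√det(g) du¹ ⋯ duⁿ` in each chart (`inducedVolume_restrict_source`). -/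
noncomputable def inducedVolume [MeasurableSpace M] (X : M → Euc (n + 1)) : Measure M :=
  ⨆ e ∈ atlas (Euc n) M, chartVolume X e

/-- The Cahn–Hoffman field `ξ̃ = ξ ∘ ν` along a hypersurface with unit normal `ν`. -/
noncomputable def cahnHoffmanField (γ : USphere n → ℝ) (ν : M → USphere n) (p : M) :
    Euc (n + 1) :=
  cahnHoffman γ (ν p)

/-- The orthogonal projection of `dfₚ : T_pM → ℝⁿ⁺¹` to the hyperplane `w^⊥`. -/
noncomputable def tangentialDiff (f : M → Euc (n + 1)) (w : Euc (n + 1)) (p : M) :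
    TangentSpace (𝓡 n) p →L[ℝ] (ℝ ∙ w)ᗮ :=
  (ℝ ∙ w)ᗮ.orthogonalProjectionOnto ∘L diffAt f p

/-- The anisotropic shape operator `S^γ = -dξ̃ : T_pM → T_pM` of `X` with unit normal `ν`, at a
regular point `p`.  As usual, `T_pM` is identified with `dX(T_pM) = ν(p)^⊥ ⊂ ℝⁿ⁺¹` through the
isomorphism `dXₚ`; the values of `dξ̃ₚ` lie in `ν(p)^⊥` too. -/
noncomputable def anisotropicShapeOperator (γ : USphere n → ℝ) (X : M → Euc (n + 1))
    (ν : M → USphere n) (p : M) : Euc n →ₗ[ℝ] Euc n :=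
  (-((tangentialDiff X (ν p) p).inverse ∘L tangentialDiff (cahnHoffmanField γ ν) (ν p) p) :
    TangentSpace (𝓡 n) p →L[ℝ] TangentSpace (𝓡 n) p).toLinearMap

/-- The anisotropic principal curvatures: the (complex) eigenvalues of the anisotropic shape
operator, with multiplicity. -/
noncomputable def anisotropicPrincipalCurvatures (γ : USphere n → ℝ) (X : M → Euc (n + 1))
    (ν : M → USphere n) (p : M) : Multiset ℂ :=
  ((anisotropicShapeOperator γ X ν p).charpoly.map (algebraMap ℝ ℂ)).roots

/-- The `r`-th anisotropic mean curvature `H_r = σ_r / (n choose r)`, where `σ_r` is the `r`-th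
elementary symmetric function of the anisotropic principal curvatures (a real number, see
`esymm_anisotropicPrincipalCurvatures_im`). -/
noncomputable def anisotropicMeanCurvature (γ : USphere n → ℝ) (X : M → Euc (n + 1))
    (ν : M → USphere n) (r : ℕ) (p : M) : ℝ :=
  ((anisotropicPrincipalCurvatures γ X ν p).esymm r).re / (n.choose r : ℝ)

theorem esymm_anisotropicPrincipalCurvatures_im (γ : USphere n → ℝ) (X : M → Euc (n + 1))
    (ν : M → USphere n) (r : ℕ) (p : M) :
    ((anisotropicPrincipalCurvatures γ X ν p).esymm r).im = 0 := by
  unfold anisotropicPrincipalCurvatures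
  set q := (anisotropicShapeOperator γ X ν p).charpoly with hq
  set Q := q.map (algebraMap ℝ ℂ) with hQ
  have hm : Q.Monic := (LinearMap.charpoly_monic _).map _
  have hs : Q.Splits := IsAlgClosed.splits Q
  rcases le_or_gt r Q.natDegree with hr | hr
  · have h := Polynomial.coeff_eq_esymm_roots_of_splits hs (Nat.sub_le Q.natDegree r)
    rw [hm.leadingCoeff, one_mul, Nat.sub_sub_self hr, hQ, Polynomial.coeff_map, ← hQ] at h
    have h2 : Q.roots.esymm r = (((-1) ^ r * q.coeff (Q.natDegree - r) : ℝ) : ℂ) := by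
      have h3 : ((-1 : ℂ) ^ r) * (-1) ^ r = 1 := by rw [← mul_pow]; simp
      have h4 : (algebraMap ℝ ℂ) (q.coeff (Q.natDegree - r)) =
        ((q.coeff (Q.natDegree - r) : ℝ) : ℂ) := rfl
      rw [h4] at h
      push_cast
      rw [h, ← mul_assoc, h3, one_mul]
    rw [h2]
    exact Complex.ofReal_im _
  · have hc : Q.roots.card < r := lt_of_le_of_lt (Polynomial.card_roots' Q) hr
    rw [Multiset.esymm, Multiset.powersetCard_eq_empty _ hc]
    simp

end Hypersurface

/-- At a regular point, the anisotropic shape operator is characterized by `dX ∘ S^γ = -dξ̃` (up to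
the projection to `ν^⊥`, which acts as the identity on the values of `dX`). -/
theorem tangentialDiff_anisotropicShapeOperator {n : ℕ} {M : Type*} [TopologicalSpace M]
    [ChartedSpace (Euc n) M] (γ : USphere n → ℝ) (X : M → Euc (n + 1))
    (ν : M → USphere n) (p : M) (hinj : Function.Injective (diffAt X p))
    (hnormal : ∀ v, inner ℝ (ν p : Euc (n + 1)) (diffAt X p v) = 0) (v : TangentSpace (𝓡 n) p) :
    tangentialDiff X (ν p) p (anisotropicShapeOperator γ X ν p v) =
      -tangentialDiff (cahnHoffmanField γ ν) (ν p) p v := by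
  have : Fact (Module.finrank ℝ (Euc (n + 1)) = n + 1) := ⟨by simp⟩
  let L : Euc n →L[ℝ] (ℝ ∙ (ν p : Euc (n + 1)))ᗮ := tangentialDiff X (ν p) p
  have hL : Function.Injective L := by
    intro a b hab
    refine hinj ?_
    have h : ∀ w : Euc n, ((L w : (ℝ ∙ (ν p : Euc (n + 1)))ᗮ) : Euc (n + 1)) = diffAt X p w := by
      intro w
      refine Submodule.starProjection_eq_self_iff.2 ?_
      exact Submodule.mem_orthogonal_singleton_iff_inner_right.2 (hnormal w)
    rw [← h a, ← h b, hab]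
  have hdim : Module.finrank ℝ (Euc n) = Module.finrank ℝ (ℝ ∙ (ν p : Euc (n + 1)))ᗮ := by
    rw [Submodule.finrank_orthogonal_span_singleton (n := n) (ne_zero_of_mem_unit_sphere (ν p))]
    simp
  let Φ := (LinearEquiv.ofInjectiveOfFinrankEq L.toLinearMap hL hdim).toContinuousLinearEquiv
  have hΦ : (Φ : Euc n →L[ℝ] (ℝ ∙ (ν p : Euc (n + 1)))ᗮ) = L := by
    ext1 w
    rfl
  have hinv : L.inverse = (Φ.symm : (ℝ ∙ (ν p : Euc (n + 1)))ᗮ →L[ℝ] Euc n) := by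
    rw [← hΦ, ContinuousLinearMap.inverse_equiv]
  let B : Euc n →L[ℝ] (ℝ ∙ (ν p : Euc (n + 1)))ᗮ :=
    tangentialDiff (cahnHoffmanField γ ν) (ν p) p
  change L (-(L.inverse (B v))) = -(B v)
  rw [map_neg, hinv, ← hΦ]
  simp

/-! ### The induced volume in charts -/

section VolumeChart

variable {n : ℕ} {M : Type*} [TopologicalSpace M]

theorem volumeDensity_eq_of_fderiv (X : M → Euc (n + 1)) (e e' : OpenPartialHomeomorph M (Euc n))
    (u w : Euc n) (J : Euc n →L[ℝ] Euc n)
    (h : fderiv ℝ (X ∘ e'.symm) u = (fderiv ℝ (X ∘ e.symm) w).comp J) :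
    volumeDensity X e' u = |J.det| * volumeDensity X e w := by
  let b := (EuclideanSpace.basisFun (Fin n) ℝ).toBasis
  let A : Matrix (Fin n) (Fin n) ℝ := LinearMap.toMatrix b b J.toLinearMap
  have hA : ∀ i, chartPartial X e' u i = ∑ j, A j i • chartPartial X e w j := by
    intro i
    have h1 : J (EuclideanSpace.single i 1) = ∑ j, A j i • EuclideanSpace.single j (1 : ℝ) := by
      have := b.sum_repr (J (b i))
      simp only [A, LinearMap.toMatrix_apply]
      simpa [b] using this.symm
    simp only [chartPartial, h, ContinuousLinearMap.comp_apply, h1, map_sum, map_smul]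
  have hG : Matrix.gram ℝ (chartPartial X e' u) =
      A.transpose * Matrix.gram ℝ (chartPartial X e w) * A := by
    ext i j
    simp only [Matrix.gram_apply, hA, Matrix.mul_apply, Matrix.transpose_apply, sum_inner,
      inner_sum, inner_smul_left, inner_smul_right, Finset.sum_mul]
    refine Finset.sum_congr rfl fun k _ => ?_
    rw [Finset.mul_sum]
    refine Finset.sum_congr rfl fun l _ => ?_
    rw [real_inner_comm]
    simp
    ring
  have hdet : J.det = A.det := by
    simp only [A, LinearMap.det_toMatrix, ContinuousLinearMap.det]
  rw [volumeDensity, volumeDensity, hG, Matrix.det_mul, Matrix.det_mul, Matrix.det_transpose, hdet]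
  rw [show A.det * (Matrix.gram ℝ (chartPartial X e w)).det * A.det =
    A.det ^ 2 * (Matrix.gram ℝ (chartPartial X e w)).det by ring,
    Real.sqrt_mul (sq_nonneg _), Real.sqrt_sq_eq_abs]

theorem measurableSet_image_chart [MeasurableSpace M] [BorelSpace M]
    (e : OpenPartialHomeomorph M (Euc n)) {S : Set M} (hS : MeasurableSet S) :
    MeasurableSet (e '' (S ∩ e.source)) := by
  rw [inter_comm, e.image_source_inter_eq']
  have hgc : Continuous (e.target.domRestrict e.symm) :=
    continuousOn_iff_continuous_domRestrict.1 e.continuousOn_symm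
  have := e.open_target.measurableSet.subtype_image (hgc.measurable hS)
  convert! this using 1
  ext u
  simp [Set.domRestrict, and_comm]

theorem chartVolume_apply [MeasurableSpace M] [BorelSpace M] (X : M → Euc (n + 1))
    (e : OpenPartialHomeomorph M (Euc n)) {S : Set M} (hS : MeasurableSet S) :
    chartVolume X e S =
      ∫⁻ u in e '' (S ∩ e.source), ENNReal.ofReal (volumeDensity X e u) := by
  have hm : AEMeasurable e.symm ((volume.restrict e.target).withDensity
      fun u => ENNReal.ofReal (volumeDensity X e u)) :=
    (e.continuousOn_symm.aemeasurable e.open_target.measurableSet).mono_ac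
      (withDensity_absolutelyContinuous _ _)
  have him : e '' (S ∩ e.source) = e.target ∩ e.symm ⁻¹' S := by
    rw [inter_comm, e.image_source_inter_eq']
  rw [chartVolume, Measure.map_apply_of_aemeasurable hm hS, him]
  rw [withDensity_apply', Measure.restrict_restrict' e.open_target.measurableSet, inter_comm]

theorem chartVolume_compl_source [MeasurableSpace M] [BorelSpace M] (X : M → Euc (n + 1))
    (e : OpenPartialHomeomorph M (Euc n)) : chartVolume X e e.sourceᶜ = 0 := by
  rw [chartVolume_apply X e e.open_source.measurableSet.compl]
  simp

variable [ChartedSpace (Euc n) M]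

theorem differentiableAt_transition [IsManifold (𝓡 n) ∞ M]
    {e e' : OpenPartialHomeomorph M (Euc n)} (he : e ∈ atlas (Euc n) M)
    (he' : e' ∈ atlas (Euc n) M) {u : Euc n} (hu : u ∈ (e.symm.trans e').source) :
    DifferentiableAt ℝ (e.symm.trans e') u := by
  have h1 := (contDiffGroupoid ∞ (𝓡 n)).compatible he he'
  have h2 := (contMDiffOn_of_mem_contDiffGroupoid h1).contDiffOn
  exact ((h2 u hu).contDiffAt ((e.symm.trans e').open_source.mem_nhds hu)).differentiableAt
    (by simp)

theorem fderiv_comp_symm_transition [IsManifold (𝓡 n) ∞ M] (X : M → Euc (n + 1))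
    {e e' : OpenPartialHomeomorph M (Euc n)} (he : e ∈ atlas (Euc n) M)
    (he' : e' ∈ atlas (Euc n) M) {u : Euc n} (hu : u ∈ (e'.symm.trans e).source) :
    fderiv ℝ (X ∘ e'.symm) u =
      (fderiv ℝ (X ∘ e.symm) (e'.symm.trans e u)).comp (fderiv ℝ (e'.symm.trans e) u) := by
  have aux : ∀ {e₁ e₂ : OpenPartialHomeomorph M (Euc n)} {w : Euc n},
      w ∈ (e₁.symm.trans e₂).source →
      (X ∘ e₁.symm) =ᶠ[nhds w] (X ∘ e₂.symm) ∘ (e₁.symm.trans e₂) := by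
    intro e₁ e₂ w hw
    filter_upwards [(e₁.symm.trans e₂).open_source.mem_nhds hw] with z hz
    have hz' : e₁.symm z ∈ e₂.source := by
      simp only [OpenPartialHomeomorph.trans_source, mem_inter_iff, mem_preimage] at hz
      exact hz.2
    simp [e₂.left_inv hz']
  have hτ := differentiableAt_transition he' he hu
  by_cases hd : DifferentiableAt ℝ (X ∘ e.symm) (e'.symm.trans e u)
  · rw [(aux hu).fderiv_eq]
    exact fderiv_comp u hd hτ
  · rw [fderiv_zero_of_not_differentiableAt hd, ContinuousLinearMap.zero_comp]
    refine fderiv_zero_of_not_differentiableAt fun hd' => hd ?_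
    have hw : e'.symm.trans e u ∈ (e.symm.trans e').source := by
      simp only [OpenPartialHomeomorph.trans_source, mem_inter_iff, mem_preimage,
        OpenPartialHomeomorph.symm_source, OpenPartialHomeomorph.coe_trans,
        Function.comp_apply] at hu ⊢
      refine ⟨e.map_source hu.2, ?_⟩
      rw [e.left_inv hu.2]
      exact e'.map_target hu.1
    have hback : e.symm.trans e' (e'.symm.trans e u) = u := by
      simp only [OpenPartialHomeomorph.trans_source, mem_inter_iff, mem_preimage,
        OpenPartialHomeomorph.symm_source] at hu
      simp [e.left_inv hu.2, e'.right_inv hu.1]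
    refine DifferentiableAt.congr_of_eventuallyEq ?_ (aux hw)
    refine DifferentiableAt.comp _ ?_ (differentiableAt_transition he he' hw)
    rw [hback]
    exact hd'

/-- The measures `√det(g) du¹ ⋯ duⁿ` of two charts agree on the overlap of the charts. -/
theorem chartVolume_overlap [IsManifold (𝓡 n) ∞ M] [MeasurableSpace M] [BorelSpace M]
    (X : M → Euc (n + 1)) {e e' : OpenPartialHomeomorph M (Euc n)}
    (he : e ∈ atlas (Euc n) M) (he' : e' ∈ atlas (Euc n) M) {S : Set M} (hS : MeasurableSet S)
    (hSe : S ⊆ e.source) (hSe' : S ⊆ e'.source) :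
    chartVolume X e S = chartVolume X e' S := by
  rw [chartVolume_apply X e hS, chartVolume_apply X e' hS, inter_eq_left.2 hSe,
    inter_eq_left.2 hSe']
  have hsub : e' '' S ⊆ (e'.symm.trans e).source := by
    rintro _ ⟨p, hp, rfl⟩
    simp [e'.map_source (hSe' hp), e'.left_inv (hSe' hp), hSe hp]
  have himg : e '' S = e'.symm.trans e '' (e' '' S) := by
    rw [image_image]
    refine image_congr fun p hp => ?_
    simp [e'.left_inv (hSe' hp)]
  have hmeas : MeasurableSet (e' '' S) := by
    have := measurableSet_image_chart e' hS
    rwa [inter_eq_left.2 hSe'] at this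
  rw [himg, lintegral_image_eq_lintegral_abs_det_fderiv_mul volume hmeas
    (fun u hu => (differentiableAt_transition he' he (hsub hu)).hasFDerivAt.hasFDerivWithinAt)
    ((e'.symm.trans e).injOn.mono hsub)]
  refine setLIntegral_congr_fun hmeas fun u hu => ?_
  have := volumeDensity_eq_of_fderiv X e e' u _ _
    (fderiv_comp_symm_transition X he he' (hsub hu))
  simp only [this, ENNReal.ofReal_mul (abs_nonneg _)]

/-- In each chart, the induced volume is `√det(g) du¹ ⋯ duⁿ`. -/
theorem inducedVolume_restrict_source [IsManifold (𝓡 n) ∞ M] [MeasurableSpace M] [BorelSpace M]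
    (X : M → Euc (n + 1)) {e : OpenPartialHomeomorph M (Euc n)} (he : e ∈ atlas (Euc n) M) :
    (inducedVolume X).restrict e.source = chartVolume X e := by
  have hms := e.open_source.measurableSet
  refine le_antisymm ?_ ?_
  · have hle : inducedVolume X ≤ chartVolume X e + (inducedVolume X).restrict e.sourceᶜ := by
      refine iSup₂_le fun e' he' => Measure.le_iff.2 fun S hS => ?_
      rw [← measure_inter_add_sdiff S hms, Measure.add_apply, Measure.restrict_apply hS]
      refine add_le_add ?_ ?_
      · have h1 : chartVolume X e' (S ∩ e.source) =
            chartVolume X e' (S ∩ e.source ∩ e'.source) := by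
          rw [← measure_inter_add_sdiff (S ∩ e.source) e'.open_source.measurableSet]
          rw [measure_mono_null (s := (S ∩ e.source) \ e'.source) (fun p hp => hp.2)
            (chartVolume_compl_source X e'), add_zero]
        rw [h1, chartVolume_overlap X he' he ((hS.inter hms).inter e'.open_source.measurableSet)
          inter_subset_right (inter_subset_left.trans inter_subset_right)]
        exact measure_mono (inter_subset_left.trans inter_subset_left)
      · exact (le_iSup₂ (f := fun e (_ : e ∈ atlas (Euc n) M) => chartVolume X e) e' he') _
    refine (Measure.restrict_mono_measure hle _).trans ?_
    rw [Measure.restrict_add, Measure.restrict_restrict hms]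
    simp [Measure.restrict_le_self]
  · refine Measure.le_iff.2 fun S hS => ?_
    rw [Measure.restrict_apply hS, ← measure_inter_add_sdiff S hms]
    rw [measure_mono_null (s := S \ e.source) (fun p hp => hp.2) (chartVolume_compl_source X e),
      add_zero]
    exact (le_iSup₂ (f := fun e (_ : e ∈ atlas (Euc n) M) => chartVolume X e) e he) _

end VolumeChart

/-! ### The first variation of the enclosed volume -/

section FirstVariation

open Filter Topology Function

variable {n : ℕ} {E : Type*} [NormedAddCommGroup E] [NormedSpace ℝ E]

/-! The edge condition says that the fields `ξ ∘ ν i` glue to one field `Ξ` on `M`, so the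
anisotropic parallel maps `Y = X + t Ξ` are closed hypersurfaces, in general singular. With `D` the
volume form, the first variation of the enclosed volume `(n+1)⁻¹ ∫ D(Y, ∂₁Y, …, ∂ₙY)` in a direction
`Z` can be written in two ways: differentiation under the integral gives `(n+1)⁻¹ ∫ (D(Z, ∂Y) + ∑ⱼ
D(Y, …, ∂ⱼZ, …))`, and integration by parts gives `∫ D(Z, ∂Y)`. Up to the factor `n+1` their
difference is the integral of `variationForm`, which therefore vanishes.

Take `Z = X`. Inside a piece `dξ̃` is tangential and `dY = dX ∘ (1 - t S)`, with `S` the anisotropic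
shape operator. All terms become determinants of `(1 + s) - t S`, that is, elementary symmetric
functions of the principal curvatures, and the integrand is `-t ∑ (-t)^r (n-r) (n choose r) (γ(ν)
H_r + ⟨X, ν⟩ H_{r+1}) dA`, summed over `r < n` (`IsPiecewiseWeakImmersion.variationForm_chartAt`).
Its integral is zero for every `t ≠ 0`, so each coefficient of this polynomial in `t` vanishes.

Stokes' theorem is never applied to the individual pieces. For smooth maps `variationForm` is a
divergence (`variationForm_eq_sum_fderiv`); mollification extends the vanishing of its integral to
Lipschitz maps (`integral_variationForm_of_lipschitzWith`), and a partition of unity carries it to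
`M` (`integral_variationDensity`). A map that is `C¹` up to the boundary on each of finitely many
closed pieces covering `M` is Lipschitz in charts (`locallyLipschitzOn_of_contDiffWithinAt`), and
the edges are null sets (`volume_eq_zero_of_fderiv_ne_zero`), so they contribute nothing. -/

/-- The partial derivatives of a map on `ℝⁿ`. -/
noncomputable def coordDeriv (f : Euc n → E) (u : Euc n) (i : Fin n) : E :=
  fderiv ℝ f u (EuclideanSpace.single i 1)

/-- The integrand `n D(z, ∂₁y, …, ∂ₙy) - ∑ⱼ D(y, ∂₁y, …, ∂ⱼz, …, ∂ₙy)`, as a function of the values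
`y`, `z` and of the derivatives `A = ∂y`, `B = ∂z`. -/
noncomputable def variationForm (D : E [⋀^Fin (n + 1)]→L[ℝ] ℝ) (y z : E) (A B : Fin n → E) : ℝ :=
  n * D (Fin.cons z A) - ∑ j, D (Fin.cons y (update A j (B j)))

theorem fderiv_alternating_comp {ι F : Type*} [Fintype ι] [DecidableEq ι] [NormedAddCommGroup F]
    [NormedSpace ℝ F] (D : E [⋀^ι]→L[ℝ] ℝ) {m : F → ι → E} {u : F}
    (hm : ∀ i, DifferentiableAt ℝ (fun w => m w i) u) (v : F) :
    fderiv ℝ (fun w => D (m w)) u v =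
      ∑ i, D (update (m u) i (fderiv ℝ (fun w => m w i) u v)) := by
  have h1 : HasFDerivAt m (ContinuousLinearMap.pi fun i => fderiv ℝ (fun w => m w i) u) u :=
    hasFDerivAt_pi.2 fun i => (hm i).hasFDerivAt
  have h2 := (D.toContinuousMultilinearMap.hasFDerivAt (m u)).comp u h1
  have h3 : fderiv ℝ (fun w => D (m w)) u = _ := h2.fderiv
  rw [h3]
  simp [ContinuousMultilinearMap.linearDeriv_apply]

/-- Integration by parts against the constant function `1`. -/
theorem integral_fderiv_apply_eq_zero {f : Euc n → ℝ} (hf : ContDiff ℝ 1 f)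
    (hc : HasCompactSupport f) (v : Euc n) : ∫ u, fderiv ℝ f u v = 0 := by
  have hcont : Continuous fun u => fderiv ℝ f u v :=
    (hf.continuous_fderiv one_ne_zero).clm_apply continuous_const
  have hc' : HasCompactSupport fun u => fderiv ℝ f u v :=
    (hc.fderiv (𝕜 := ℝ)).comp_left (g := fun L : Euc n →L[ℝ] ℝ => L v) rfl
  have := integral_mul_fderiv_eq_neg_fderiv_mul_of_integrable (μ := volume) (𝕜 := ℝ)
    (f := fun _ : Euc n => (1 : ℝ)) (g := f) (v := v) (by simp)
    (by simpa using hcont.integrable_of_hasCompactSupport hc')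
    (by simpa using hf.continuous.integrable_of_hasCompactSupport hc)
    (fun _ _ => differentiableAt_const _) (fun _ _ => hf.differentiable one_ne_zero _)
  simpa using this

theorem sum_sum_eq_zero_of_antisymm {ι : Type*} [Fintype ι] (a : ι → ι → ℝ)
    (h : ∀ j k, a j k = -a k j) : ∑ j, ∑ k, a j k = 0 := by
  have h1 : ∑ j, ∑ k, a j k = -∑ j, ∑ k, a j k := by
    conv_lhs => rw [Finset.sum_comm]
    simp only [← Finset.sum_neg_distrib]
    exact Finset.sum_congr rfl fun j _ => Finset.sum_congr rfl fun k _ => h k j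
  linarith

theorem alternating_cons_update_swap (D : E [⋀^Fin (n + 1)]→L[ℝ] ℝ) (y w : E) (A : Fin n → E)
    (j : Fin n) :
    D (Fin.cons w (update A j y)) = -D (Fin.cons y (update A j w)) := by
  have h := D.toAlternatingMap.map_swap (Fin.cons y (update A j w) : Fin (n + 1) → E)
    (i := 0) (j := j.succ) (Fin.succ_ne_zero j).symm
  have h2 : (Fin.cons y (update A j w) : Fin (n + 1) → E) ∘ Equiv.swap 0 j.succ =
      Fin.cons w (update A j y) := by
    funext i
    refine Fin.cases ?_ (fun k => ?_) i
    · simp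
    · rcases eq_or_ne k j with rfl | hk
      · simp [update_of_ne (Fin.succ_ne_zero k).symm]
      · rw [comp_apply, Equiv.swap_apply_of_ne_of_ne (Fin.succ_ne_zero k)
          (fun h => hk (Fin.succ_injective _ h))]
        simp [hk]
  rw [h2] at h
  exact h

theorem alternating_cons_update_update_swap (D : E [⋀^Fin (n + 1)]→L[ℝ] ℝ) (z y w : E)
    (A : Fin n → E) {j k : Fin n} (hjk : k ≠ j) :
    D (Fin.cons z (update (update A j y) k w)) = -D (Fin.cons z (update (update A k y) j w)) := by
  have h := D.toAlternatingMap.map_swap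
    (Fin.cons z (update (update A k y) j w) : Fin (n + 1) → E)
    (i := k.succ) (j := j.succ) (fun h => hjk (Fin.succ_injective _ h))
  have h2 : (Fin.cons z (update (update A k y) j w) : Fin (n + 1) → E) ∘
      Equiv.swap k.succ j.succ = Fin.cons z (update (update A j y) k w) := by
    funext i
    refine Fin.cases ?_ (fun l => ?_) i
    · rw [comp_apply, Equiv.swap_apply_of_ne_of_ne (Fin.succ_ne_zero k).symm
        (Fin.succ_ne_zero j).symm]
      simp
    · rcases eq_or_ne l j with rfl | hl
      · simp [hjk, hjk.symm]
      · rcases eq_or_ne l k with rfl | hl'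
        · simp
        · rw [comp_apply, Equiv.swap_apply_of_ne_of_ne (fun h => hl' (Fin.succ_injective _ h))
            (fun h => hl (Fin.succ_injective _ h))]
          simp [hl, hl']
  rw [h2] at h
  exact h

theorem contDiff_coordDeriv {f : Euc n → E} {m : ℕ} (hf : ContDiff ℝ (m + 1 : ℕ) f) (i : Fin n) :
    ContDiff ℝ m fun u => coordDeriv f u i :=
  (hf.fderiv_right (m := m) (by norm_cast)).clm_apply contDiff_const

/-- Expand the divergence by the product rule. Differentiating `z` gives, after one transposition,
the terms with a minus sign; differentiating the `y` in slot `j` restores `D(z, ∂y)`, once for each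
of the `n` values of `j`. What remains contains `∂ⱼ∂ₖy`, symmetric in `j, k`, while `D` is
antisymmetric in the two slots, so these terms cancel in pairs. -/
theorem variationForm_eq_sum_fderiv (D : E [⋀^Fin (n + 1)]→L[ℝ] ℝ) {y z : Euc n → E}
    (hy : ContDiff ℝ 2 y) (hz : ContDiff ℝ 2 z) (u : Euc n) :
    variationForm D (y u) (z u) (coordDeriv y u) (coordDeriv z u) =
      ∑ j, fderiv ℝ (fun w => D (Fin.cons (z w) (update (coordDeriv y w) j (y w)))) u
        (EuclideanSpace.single j 1) := by
  have hyd : Differentiable ℝ y := hy.differentiable (by norm_num)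
  have hzd : Differentiable ℝ z := hz.differentiable (by norm_num)
  have hcd : ∀ k, Differentiable ℝ fun w => coordDeriv y w k := fun k =>
    (contDiff_coordDeriv (m := 1) hy k).differentiable (by norm_num)
  let c : Fin n → Fin n → E := fun j k =>
    fderiv ℝ (fun w => coordDeriv y w k) u (EuclideanSpace.single j 1)
  have hsymm : ∀ j k, c j k = c k j := by
    intro j k
    have hd : DifferentiableAt ℝ (fderiv ℝ y) u :=
      (hy.fderiv_right (m := 1) (by norm_num)).differentiable (by norm_num) u
    have h1 : ∀ j k, c j k = fderiv ℝ (fderiv ℝ y) u (EuclideanSpace.single j 1)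
        (EuclideanSpace.single k 1) := by
      intro j k
      simp only [c, coordDeriv]
      rw [fderiv_clm_apply hd (differentiableAt_const _)]
      simp
    rw [h1, h1]
    exact (hy.contDiffAt (x := u)).isSymmSndFDerivAt (by simp) _ _
  -- The second-derivative terms. The diagonal is set to zero because slot `j` holds `y` and not
  -- `∂ⱼy`; its contribution is the separate term `D(z, ∂y)`.
  let a : Fin n → Fin n → ℝ := fun j k => if k = j then 0 else
    D (Fin.cons (z u) (update (update (coordDeriv y u) j (y u)) k (c j k)))
  have hterm : ∀ j, fderiv ℝ (fun w => D (Fin.cons (z w) (update (coordDeriv y w) j (y w)))) u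
        (EuclideanSpace.single j 1) =
      -D (Fin.cons (y u) (update (coordDeriv y u) j (coordDeriv z u j))) +
        (D (Fin.cons (z u) (coordDeriv y u)) + ∑ k, a j k) := by
    intro j
    have hcomp : ∀ k, (fun w => update (coordDeriv y w) j (y w) k) =
        if k = j then y else fun w => coordDeriv y w k := by
      intro k
      split_ifs with h
      · subst h; simp
      · funext w; simp [h]
    rw [fderiv_alternating_comp D (m := fun w => Fin.cons (z w) (update (coordDeriv y w) j (y w)))]
    · rw [Fin.sum_univ_succ]
      congr 1
      · simp only [Fin.cons_zero, Fin.update_cons_zero]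
        exact alternating_cons_update_swap D _ _ _ _
      · have hk : ∀ k : Fin n, D (update (Fin.cons (z u) (update (coordDeriv y u) j (y u))) k.succ
            (fderiv ℝ (fun w => (Fin.cons (z w) (update (coordDeriv y w) j (y w)) :
              Fin (n + 1) → E) k.succ) u (EuclideanSpace.single j 1))) =
            (if k = j then D (Fin.cons (z u) (coordDeriv y u)) else 0) + a j k := by
          intro k
          simp only [Fin.cons_succ, hcomp, a, ← Fin.cons_update]
          split_ifs with h
          · subst h
            rw [update_idem, add_zero]
            change D (Fin.cons (z u) (update (coordDeriv y u) k (coordDeriv y u k))) = _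
            rw [update_eq_self]
          · rw [zero_add]
        rw [Finset.sum_congr rfl fun k _ => hk k, Finset.sum_add_distrib]
        simp
    · refine fun i => Fin.cases ?_ (fun k => ?_) i
      · simpa using hzd u
      · simp only [Fin.cons_succ, hcomp]
        split_ifs
        · exact hyd u
        · exact hcd k u
  rw [Finset.sum_congr rfl fun j _ => hterm j, Finset.sum_add_distrib, Finset.sum_add_distrib,
    sum_sum_eq_zero_of_antisymm a]
  · simp only [variationForm, Finset.sum_neg_distrib, Finset.sum_const, Finset.card_univ,
      Fintype.card_fin, nsmul_eq_mul]
    ring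
  · intro j k
    simp only [a]
    split_ifs with h h' h'
    · simp
    · exact absurd h.symm h'
    · exact absurd h'.symm h
    · rw [hsymm j k]
      exact alternating_cons_update_update_swap D _ _ _ _ h

/-- Each component of the field whose divergence is taken has `z` in slot `0`, so compact support of
`z` alone is enough. -/
theorem integral_variationForm_of_contDiff (D : E [⋀^Fin (n + 1)]→L[ℝ] ℝ) {y z : Euc n → E}
    (hy : ContDiff ℝ 2 y) (hz : ContDiff ℝ 2 z) (hzc : HasCompactSupport z) :
    ∫ u, variationForm D (y u) (z u) (coordDeriv y u) (coordDeriv z u) = 0 := by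
  have hV : ∀ j, ContDiff ℝ 1
      fun w => D (Fin.cons (z w) (update (coordDeriv y w) j (y w))) := by
    intro j
    refine D.toContinuousMultilinearMap.contDiff.comp (contDiff_pi.2 fun i => ?_)
    refine Fin.cases ?_ (fun k => ?_) i
    · simpa using hz.of_le (by norm_num)
    · rcases eq_or_ne k j with rfl | hk
      · simpa using hy.of_le (by norm_num)
      · simpa [hk] using contDiff_coordDeriv (m := 1) hy k
  have hVc : ∀ j, HasCompactSupport
      fun w => D (Fin.cons (z w) (update (coordDeriv y w) j (y w))) := by
    intro j
    refine hzc.mono fun w hw hzw => hw ?_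
    exact D.map_coord_zero 0 (by simpa using hzw)
  simp_rw [variationForm_eq_sum_fderiv D hy hz]
  rw [integral_finsetSum]
  · exact Finset.sum_eq_zero fun j _ => integral_fderiv_apply_eq_zero (hV j) (hVc j) _
  · intro j _
    refine Continuous.integrable_of_hasCompactSupport
      (((hV j).continuous_fderiv one_ne_zero).clm_apply continuous_const) ?_
    exact ((hVc j).fderiv (𝕜 := ℝ)).comp_left
      (g := fun L : Euc n →L[ℝ] ℝ => L (EuclideanSpace.single j 1)) rfl

theorem continuous_variationForm (D : E [⋀^Fin (n + 1)]→L[ℝ] ℝ) :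
    Continuous fun p : (E × E) × ((Fin n → E) × (Fin n → E)) =>
      variationForm D p.1.1 p.1.2 p.2.1 p.2.2 := by
  unfold variationForm
  refine ((continuous_const.mul (D.cont.comp (continuous_pi fun i => ?_)))).sub
    (continuous_finsetSum _ fun j _ => D.cont.comp (continuous_pi fun i => ?_))
  · refine Fin.cases ?_ (fun k => ?_) i
    · simp only [Fin.cons_zero]; fun_prop
    · simp only [Fin.cons_succ]; fun_prop
  · refine Fin.cases ?_ (fun k => ?_) i
    · simp only [Fin.cons_zero]; fun_prop
    · rcases eq_or_ne k j with rfl | hk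
      · simp only [Fin.cons_succ, update_self]; fun_prop
      · simp only [Fin.cons_succ, update_of_ne hk]; fun_prop

theorem variationForm_zero (D : E [⋀^Fin (n + 1)]→L[ℝ] ℝ) (y : E) (A : Fin n → E) :
    variationForm D y 0 A 0 = 0 := by
  unfold variationForm
  rw [D.map_coord_zero 0 (by simp), Finset.sum_eq_zero, mul_zero, sub_zero]
  exact fun j _ => D.map_coord_zero j.succ (by simp)

end FirstVariation

/-! ### Mollification: from smooth maps to Lipschitz maps -/

section LipschitzVariation

open Filter Topology Function
open scoped Convolution NNReal

variable {n : ℕ} {E : Type*} [NormedAddCommGroup E] [NormedSpace ℝ E]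

theorem aestronglyMeasurable_fderiv [FiniteDimensional ℝ E] (y : Euc n → E) :
    AEStronglyMeasurable (fderiv ℝ y) volume :=
  (measurable_fderiv ℝ y).aestronglyMeasurable

/-- By Rademacher's theorem `y` is differentiable almost everywhere, and its Lipschitz constant
times the mollifier dominates the difference quotients, so one may differentiate under the integral.
The derivative thus falls on `y`, not on the mollifier, and stays bounded as the mollifier shrinks.
-/
theorem hasFDerivAt_convolution_of_lipschitzWith [FiniteDimensional ℝ E]
    (φ : ContDiffBump (0 : Euc n)) {y : Euc n → E} {C : ℝ≥0} (hy : LipschitzWith C y) (u : Euc n) :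
    HasFDerivAt (φ.normed volume ⋆[ContinuousLinearMap.lsmul ℝ ℝ, volume] y)
      ((φ.normed volume ⋆[ContinuousLinearMap.lsmul ℝ ℝ, volume] fderiv ℝ y) u) u := by
  have hφ : Continuous (φ.normed volume) := φ.continuous_normed
  have hφc : HasCompactSupport (φ.normed volume) := φ.hasCompactSupport_normed
  have hmp := (Measure.measurePreserving_sub_left (volume : Measure (Euc n)) u).quasiMeasurePreserving
  refine (hasFDerivAt_integral_of_dominated_loc_of_lip (𝕜 := ℝ) (μ := volume)
    (F := fun w t => φ.normed volume t • y (w - t))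
    (F' := fun t => φ.normed volume t • fderiv ℝ y (u - t))
    (bound := fun t => φ.normed volume t * C) univ_mem ?_ ?_ ?_ ?_ ?_ ?_).2
  · refine Eventually.of_forall fun w => Continuous.aestronglyMeasurable ?_
    exact hφ.smul (hy.continuous.comp (continuous_const.sub continuous_id))
  · refine Continuous.integrable_of_hasCompactSupport ?_ hφc.smul_right
    exact hφ.smul (hy.continuous.comp (continuous_const.sub continuous_id))
  · exact hφ.aestronglyMeasurable.smul
      ((aestronglyMeasurable_fderiv y).comp_quasiMeasurePreserving hmp)
  · refine Eventually.of_forall fun t => LipschitzWith.lipschitzOnWith ?_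
    refine LipschitzWith.of_dist_le_mul fun w w' => ?_
    rw [dist_smul₀, Real.coe_nnabs, abs_mul, NNReal.abs_eq, mul_assoc, Real.norm_eq_abs]
    refine mul_le_mul_of_nonneg_left ?_ (abs_nonneg _)
    simpa using hy.dist_le_mul (w - t) (w' - t)
  · exact (hφ.mul continuous_const).integrable_of_hasCompactSupport hφc.mul_right
  · filter_upwards [hmp.ae hy.ae_differentiableAt] with t ht
    have h1 : HasFDerivAt (fun w => y (w - t)) (fderiv ℝ y (u - t)) u :=
      by
      have h2 := ht.hasFDerivAt.comp u ((hasFDerivAt_id (𝕜 := ℝ) u).sub_const t)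
      rw [ContinuousLinearMap.comp_id] at h2
      exact h2
    exact h1.const_smul _

/-- The convolution is an average of values of `g`, which all lie within `2C` of `g u`; adding `‖g
u‖ ≤ C` gives `3C`. The constant is not sharp; only its independence of `φ` matters. -/
theorem norm_normed_convolution_le (φ : ContDiffBump (0 : Euc n)) {F : Type*}
    [NormedAddCommGroup F] [NormedSpace ℝ F] [CompleteSpace F] {g : Euc n → F} {C : ℝ}
    (hg : AEStronglyMeasurable g volume) (hC : ∀ u, ‖g u‖ ≤ C) (u : Euc n) :
    ‖(φ.normed volume ⋆[ContinuousLinearMap.lsmul ℝ ℝ, volume] g) u‖ ≤ 3 * C := by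
  have h := φ.dist_normed_convolution_le (μ := volume) (x₀ := u) (ε := 2 * C) hg fun x _ => by
    rw [dist_eq_norm]
    linarith [norm_sub_le (g x) (g u), hC x, hC u]
  rw [dist_eq_norm] at h
  have := norm_sub_norm_le ((φ.normed volume ⋆[ContinuousLinearMap.lsmul ℝ ℝ, volume] g) u) (g u)
  linarith [hC u]

theorem norm_coordDeriv_le (f : Euc n → E) (u : Euc n) :
    ‖coordDeriv f u‖ ≤ ‖fderiv ℝ f u‖ := by
  refine (pi_norm_le_iff_of_nonneg (norm_nonneg _)).2 fun i => ?_
  simpa [coordDeriv] using (fderiv ℝ f u).le_opNorm (EuclideanSpace.single i 1)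

theorem variationForm_eq_zero_of_notMem_tsupport (D : E [⋀^Fin (n + 1)]→L[ℝ] ℝ)
    {y z : Euc n → E} {u : Euc n} (hu : u ∉ tsupport z) :
    variationForm D (y u) (z u) (coordDeriv y u) (coordDeriv z u) = 0 := by
  have h0 : z =ᶠ[𝓝 u] 0 := notMem_tsupport_iff_eventuallyEq.1 hu
  have h1 : coordDeriv z u = 0 := by
    funext i
    simp [coordDeriv, h0.fderiv_eq]
  rw [h1, show z u = 0 from h0.eq_of_nhds, variationForm_zero]

theorem tendsto_variationForm (D : E [⋀^Fin (n + 1)]→L[ℝ] ℝ) {ι : Type*} {l : Filter ι}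
    {y z : ι → E} {A B : ι → Fin n → E} {y₀ z₀ : E} {A₀ B₀ : Fin n → E}
    (hy : Tendsto y l (𝓝 y₀)) (hz : Tendsto z l (𝓝 z₀)) (hA : Tendsto A l (𝓝 A₀))
    (hB : Tendsto B l (𝓝 B₀)) :
    Tendsto (fun k => variationForm D (y k) (z k) (A k) (B k)) l
      (𝓝 (variationForm D y₀ z₀ A₀ B₀)) :=
  ((continuous_variationForm D).tendsto ((y₀, z₀), (A₀, B₀))).comp
    ((hy.prodMk_nhds hz).prodMk_nhds (hA.prodMk_nhds hB))

theorem exists_bound_variationForm [FiniteDimensional ℝ E] (D : E [⋀^Fin (n + 1)]→L[ℝ] ℝ) (C : ℝ) :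
    ∃ K, ∀ (y z : E) (A B : Fin n → E), ‖y‖ ≤ C → ‖z‖ ≤ C → ‖A‖ ≤ C → ‖B‖ ≤ C →
      ‖variationForm D y z A B‖ ≤ K := by
  have : ProperSpace E := FiniteDimensional.proper_real E
  obtain ⟨K, hK⟩ := (isCompact_closedBall
    (0 : (E × E) × ((Fin n → E) × (Fin n → E))) C).exists_bound_of_continuousOn
    (continuous_variationForm D).continuousOn
  refine ⟨K, fun y z A B hy hz hA hB => hK ((y, z), (A, B)) ?_⟩
  rw [mem_closedBall_zero_iff]
  exact max_le (max_le hy hz) (max_le hA hB)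

theorem exists_bound_of_lipschitzWith {y : Euc n → E} {C : ℝ≥0} (hy : LipschitzWith C y)
    (hyc : HasCompactSupport y) : ∃ K, ∀ u, ‖y u‖ ≤ K ∧ ‖fderiv ℝ y u‖ ≤ K := by
  obtain ⟨K, hK⟩ := hyc.exists_bound_of_continuous hy.continuous
  exact ⟨max K C, fun u => ⟨(hK u).trans (le_max_left _ _),
    (norm_fderiv_le_of_lipschitz ℝ hy).trans (le_max_right _ _)⟩⟩

theorem aestronglyMeasurable_variationForm [FiniteDimensional ℝ E]
    (D : E [⋀^Fin (n + 1)]→L[ℝ] ℝ) {y z : Euc n → E}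
    (hy : Continuous y) (hz : Continuous z) :
    AEStronglyMeasurable
      (fun u => variationForm D (y u) (z u) (coordDeriv y u) (coordDeriv z u)) volume := by
  have h : ∀ f : Euc n → E, AEStronglyMeasurable (fun u => coordDeriv f u) volume := fun f =>
    Continuous.comp_aestronglyMeasurable
      (g := fun (L : Euc n →L[ℝ] E) (i : Fin n) => L (EuclideanSpace.single i 1))
      (by fun_prop) (aestronglyMeasurable_fderiv f)
  exact (continuous_variationForm D).comp_aestronglyMeasurable
    ((hy.aestronglyMeasurable.prodMk hz.aestronglyMeasurable).prodMk ((h y).prodMk (h z)))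

theorem integrable_variationForm [FiniteDimensional ℝ E]
    (D : E [⋀^Fin (n + 1)]→L[ℝ] ℝ) {y z : Euc n → E} {C C' : ℝ≥0}
    (hy : LipschitzWith C y) (hz : LipschitzWith C' z) (hyc : HasCompactSupport y)
    (hzc : HasCompactSupport z) :
    Integrable fun u => variationForm D (y u) (z u) (coordDeriv y u) (coordDeriv z u) := by
  obtain ⟨K₁, h₁⟩ := exists_bound_of_lipschitzWith hy hyc
  obtain ⟨K₂, h₂⟩ := exists_bound_of_lipschitzWith hz hzc
  obtain ⟨K, hK⟩ := exists_bound_variationForm D (max K₁ K₂)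
  have hK' : ∀ u, ‖variationForm D (y u) (z u) (coordDeriv y u) (coordDeriv z u)‖ ≤ K := fun u =>
    hK _ _ _ _ ((h₁ u).1.trans (le_max_left _ _)) ((h₂ u).1.trans (le_max_right _ _))
      ((norm_coordDeriv_le y u).trans ((h₁ u).2.trans (le_max_left _ _)))
      ((norm_coordDeriv_le z u).trans ((h₂ u).2.trans (le_max_right _ _)))
  refine (integrableOn_iff_integrable_of_support_subset (s := tsupport z) fun u hu => ?_).1 ?_
  · by_contra h
    exact hu (variationForm_eq_zero_of_notMem_tsupport D h)
  · exact Measure.integrableOn_of_bounded hzc.measure_lt_top.ne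
      (aestronglyMeasurable_variationForm D hy.continuous hz.continuous)
      (Eventually.of_forall hK')

theorem contDiff_normed_convolution [FiniteDimensional ℝ E]
    (φ : ContDiffBump (0 : Euc n)) {y : Euc n → E}
    (hy : Continuous y) :
    ContDiff ℝ 2 (φ.normed volume ⋆[ContinuousLinearMap.lsmul ℝ ℝ, volume] y) :=
  φ.hasCompactSupport_normed.contDiff_convolution_left _ φ.contDiff_normed hy.locallyIntegrable

/-- The first variation formula for the volume enclosed by a Lipschitz hypersurface. -/
theorem integral_variationForm_of_lipschitzWith [FiniteDimensional ℝ E]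
    (D : E [⋀^Fin (n + 1)]→L[ℝ] ℝ) {y z : Euc n → E}
    {C C' : ℝ≥0} (hy : LipschitzWith C y) (hz : LipschitzWith C' z) (hyc : HasCompactSupport y)
    (hzc : HasCompactSupport z) :
    ∫ u, variationForm D (y u) (z u) (coordDeriv y u) (coordDeriv z u) = 0 := by
  -- The outer radius tends to `0`, and its ratio to the inner radius is fixed at `2`: bounded
  -- eccentricity is what gives almost everywhere convergence of the mollified derivatives, which
  -- are merely locally integrable.
  let φ : ℕ → ContDiffBump (0 : Euc n) := fun k =>
    ⟨(1 / ((k : ℝ) + 1)) / 2, 1 / ((k : ℝ) + 1), by positivity, half_lt_self (by positivity)⟩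
  have hφ0 : Tendsto (fun k => (φ k).rOut) atTop (𝓝 0) := tendsto_one_div_add_atTop_nhds_zero_nat
  have hφ1 : ∀ᶠ k in atTop, (φ k).rOut ≤ 2 * (φ k).rIn := Eventually.of_forall fun k => by
    change 1 / ((k : ℝ) + 1) ≤ 2 * ((1 / ((k : ℝ) + 1)) / 2)
    linarith
  have hrOut : ∀ k, (φ k).rOut ≤ 1 := fun k => by
    change 1 / ((k : ℝ) + 1) ≤ 1
    rw [div_le_one (by positivity)]
    linarith [(Nat.cast_nonneg k : (0 : ℝ) ≤ k)]
  let conv : ℕ → (Euc n → E) → Euc n → E := fun k f =>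
    (φ k).normed volume ⋆[ContinuousLinearMap.lsmul ℝ ℝ, volume] f
  have hconv_c : ∀ k, HasCompactSupport (conv k z) := fun k =>
    (φ k).hasCompactSupport_normed.convolution _ hzc
  have hfd : ∀ {f : Euc n → E} {C : ℝ≥0}, LipschitzWith C f → ∀ k u, fderiv ℝ (conv k f) u =
      ((φ k).normed volume ⋆[ContinuousLinearMap.lsmul ℝ ℝ, volume] fderiv ℝ f) u :=
    fun hf k u => (hasFDerivAt_convolution_of_lipschitzWith (φ k) hf u).fderiv
  have hbd : ∀ {f : Euc n → E} {C : ℝ≥0}, LipschitzWith C f → HasCompactSupport f →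
      ∃ K, ∀ k u, ‖conv k f u‖ ≤ K ∧ ‖coordDeriv (conv k f) u‖ ≤ K := by
    intro f C hf hfc
    obtain ⟨K, hK⟩ := exists_bound_of_lipschitzWith hf hfc
    refine ⟨3 * K, fun k u => ⟨norm_normed_convolution_le (φ k) hf.continuous.aestronglyMeasurable
      (fun u => (hK u).1) u, (norm_coordDeriv_le _ u).trans ?_⟩⟩
    rw [hfd hf]
    exact norm_normed_convolution_le (φ k) (aestronglyMeasurable_fderiv f) (fun u => (hK u).2) u
  have hlim : ∀ {f : Euc n → E} {C : ℝ≥0}, LipschitzWith C f → ∀ᵐ u,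
      Tendsto (fun k => conv k f u) atTop (𝓝 (f u)) ∧
        Tendsto (fun k => coordDeriv (conv k f) u) atTop (𝓝 (coordDeriv f u)) := by
    intro f C hf
    have hli : LocallyIntegrable (fderiv ℝ f) volume :=
      (locallyIntegrable_const (C : ℝ)).mono (aestronglyMeasurable_fderiv f)
        (Eventually.of_forall fun u => by
          simpa using norm_fderiv_le_of_lipschitz ℝ hf)
    filter_upwards [ContDiffBump.ae_convolution_tendsto_right_of_locallyIntegrable hφ0 hφ1 hli]
      with u hu
    refine ⟨ContDiffBump.convolution_tendsto_right_of_continuous hφ0 hf.continuous u, ?_⟩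
    refine tendsto_pi_nhds.2 fun i => ?_
    simp only [coordDeriv, hfd hf]
    exact ((ContinuousLinearMap.apply ℝ E (EuclideanSpace.single i (1 : ℝ))).continuous.tendsto
      _).comp hu
  obtain ⟨K₁, h₁⟩ := hbd hy hyc
  obtain ⟨K₂, h₂⟩ := hbd hz hzc
  obtain ⟨K, hK⟩ := exists_bound_variationForm D (max K₁ K₂)
  -- All radii are at most `1`, so one compact set contains every support and the constant `K` on it
  -- is an integrable bound.
  have hsupp : ∀ k, tsupport (conv k z) ⊆ Metric.cthickening 1 (tsupport z) := by
    intro k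
    refine closure_minimal (fun u hu => ?_) Metric.isClosed_cthickening
    obtain ⟨a, ha, b, hb, rfl⟩ := mem_add.1 (support_convolution_subset_swap _ hu)
    rw [(φ k).support_normed_eq, Metric.mem_ball, dist_zero_right] at hb
    refine Metric.mem_cthickening_of_dist_le _ a _ _ (subset_tsupport _ ha) ?_
    rw [dist_eq_norm, add_sub_cancel_left]
    exact hb.le.trans (hrOut k)
  have hcomp : IsCompact (Metric.cthickening 1 (tsupport z)) := hzc.isCompact.cthickening
  have hdom := tendsto_integral_of_dominated_convergence (μ := volume)
    (F := fun k u => variationForm D (conv k y u) (conv k z u) (coordDeriv (conv k y) u)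
      (coordDeriv (conv k z) u))
    (f := fun u => variationForm D (y u) (z u) (coordDeriv y u) (coordDeriv z u))
    ((Metric.cthickening 1 (tsupport z)).indicator fun _ => K) ?_ ?_ ?_ ?_
  · have h0 : ∀ k, ∫ u, variationForm D (conv k y u) (conv k z u) (coordDeriv (conv k y) u)
        (coordDeriv (conv k z) u) = 0 := fun k =>
      integral_variationForm_of_contDiff D (contDiff_normed_convolution (φ k) hy.continuous)
        (contDiff_normed_convolution (φ k) hz.continuous) (hconv_c k)
    simp only [h0] at hdom
    exact tendsto_nhds_unique hdom tendsto_const_nhds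
  · exact fun k => aestronglyMeasurable_variationForm D
      (contDiff_normed_convolution (φ k) hy.continuous).continuous
      (contDiff_normed_convolution (φ k) hz.continuous).continuous
  · exact (integrable_indicator_iff hcomp.measurableSet).2
      (integrableOn_const hcomp.measure_lt_top.ne)
  · refine fun k => Eventually.of_forall fun u => ?_
    by_cases hu : u ∈ Metric.cthickening 1 (tsupport z)
    · rw [indicator_of_mem hu]
      exact hK _ _ _ _ ((h₁ k u).1.trans (le_max_left _ _)) ((h₂ k u).1.trans (le_max_right _ _))
        ((h₁ k u).2.trans (le_max_left _ _)) ((h₂ k u).2.trans (le_max_right _ _))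
    · rw [indicator_of_notMem hu,
        variationForm_eq_zero_of_notMem_tsupport D fun h => hu (hsupp k h), norm_zero]
  · filter_upwards [hlim hy, hlim hz] with u h1 h2
    exact tendsto_variationForm D h1.1 h2.1 h1.2 h2.2

end LipschitzVariation

/-! ### Piecewise `C¹` maps are Lipschitz in charts -/

section PiecewiseLipschitz

open Filter Topology Function
open scoped NNReal

/-- A mean value inequality on a convex set, for a map with a pointwise Lipschitz bound. -/
theorem Convex.lipschitzOnWith_of_eventually_norm_sub_le {V F : Type*} [NormedAddCommGroup V]
    [NormedSpace ℝ V] [NormedAddCommGroup F] {g : V → F} {S : Set V} (hS : Convex ℝ S) {C : ℝ≥0}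
    (h : ∀ z ∈ S, ∀ᶠ w in 𝓝 z, ‖g w - g z‖ ≤ C * ‖w - z‖) : LipschitzOnWith C g S := by
  refine LipschitzOnWith.of_dist_le_mul fun b hb a ha => ?_
  let c : ℝ → V := fun t => a + t • (b - a)
  have hc : Continuous c := by fun_prop
  have hcS : ∀ t ∈ Icc (0 : ℝ) 1, c t ∈ S := fun t ht => hS.add_smul_sub_mem ha hb ht
  have hev : ∀ t ∈ Icc (0 : ℝ) 1, ∀ᶠ s in 𝓝 t, ‖g (c s) - g (c t)‖ ≤ C * ‖b - a‖ * |s - t| := by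
    intro t ht
    filter_upwards [hc.continuousAt.eventually (h (c t) (hcS t ht))] with s hs
    have : c s - c t = (s - t) • (b - a) := by simp only [c, sub_smul]; abel
    rw [this, norm_smul, Real.norm_eq_abs] at hs
    linarith
  have hcont : ContinuousOn (fun t => ‖g (c t) - g a‖) (Icc 0 1) := by
    intro t ht
    refine ContinuousAt.continuousWithinAt ?_
    refine (ContinuousAt.sub ?_ continuousAt_const).norm
    refine tendsto_iff_norm_sub_tendsto_zero.2
      (squeeze_zero' (Eventually.of_forall fun _ => norm_nonneg _) (hev t ht) ?_)
    exact Continuous.tendsto' (by fun_prop) t 0 (by simp)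
  -- Along the segment, `‖g (c t) - g a‖` starts at `0` and has right slopes at most `C ‖b - a‖`, so
  -- it stays below the line of that slope.
  have key := image_le_of_liminf_slope_right_le_deriv_boundary hcont
    (B := fun t => C * ‖b - a‖ * t) (B' := fun _ => C * ‖b - a‖) (by simp [c]) (by fun_prop)
    (fun x _ => by simpa using ((hasDerivAt_id x).const_mul (C * ‖b - a‖)).hasDerivWithinAt)
    (fun t ht r hr => Eventually.frequently ?_) (right_mem_Icc.2 zero_le_one)
  · simpa [c, dist_eq_norm] using key
  · filter_upwards [nhdsWithin_le_nhds (hev t ⟨ht.1, ht.2.le⟩), self_mem_nhdsWithin] with s hs hst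
    refine lt_of_le_of_lt ?_ hr
    have hst' : 0 < s - t := sub_pos.2 hst
    rw [slope_def_field, div_le_iff₀ hst']
    rw [abs_of_pos hst'] at hs
    refine le_trans ?_ hs
    have := norm_sub_norm_le (g (c s) - g a) (g (c t) - g a)
    rwa [sub_sub_sub_cancel_right] at this

/-- Only the existence of some bounded derivative within `Q` is claimed, so `Q` need not have unique
derivatives at its boundary points. -/
theorem ContDiffWithinAt.eventually_hasFDerivWithinAt_norm_le {V F : Type*} [NormedAddCommGroup V]
    [NormedSpace ℝ V] [NormedAddCommGroup F] [NormedSpace ℝ F] {g : V → F} {Q : Set V} {x : V}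
    (h : ContDiffWithinAt ℝ 1 g Q x) (hx : x ∈ Q) :
    ∃ C, ∀ᶠ z in 𝓝 x, z ∈ Q → ∃ L : V →L[ℝ] F, ‖L‖ ≤ C ∧ HasFDerivWithinAt g L Q z := by
  obtain ⟨u, hu, -, -, f', hf', hc⟩ :=
    (contDiffWithinAt_succ_iff_hasFDerivWithinAt' (n := 0) (by simp)).1 (by simpa using h)
  rw [insert_eq_of_mem hx] at hu
  refine ⟨‖f' x‖ + 1, eventually_nhdsWithin_iff.1 ?_⟩
  filter_upwards [hu, hc.continuousWithinAt.norm.eventually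
    (gt_mem_nhds (lt_add_one ‖f' x‖))] with z hz hz'
  exact ⟨f' z, hz'.le, hf' z hz⟩

/-- The pieces may be far from convex, so the mean value inequality is not used inside them.
Instead, the pieces being closed in `U`, every `w` close enough to `z` shares a piece with `z`; the
derivative within that piece gives a pointwise Lipschitz bound at `z`. The mean value inequality is
then applied on a ball, whose segments may cross the pieces in any manner. -/
theorem locallyLipschitzOn_of_contDiffWithinAt {V F : Type*} [NormedAddCommGroup V]
    [NormedSpace ℝ V] [NormedAddCommGroup F] [NormedSpace ℝ F] {g : V → F} {U : Set V}
    (hU : IsOpen U) {k : ℕ} {Q : Fin k → Set V} (hcover : ∀ z ∈ U, ∃ i, z ∈ Q i)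
    (hclosed : ∀ i, ∀ z ∈ U, z ∉ Q i → (Q i)ᶜ ∈ 𝓝 z)
    (hg : ∀ i, ∀ z ∈ U, z ∈ Q i → ContDiffWithinAt ℝ 1 g (Q i) z) : LocallyLipschitzOn U g := by
  intro x hx
  have h1 : ∀ i, ∃ C, ∀ᶠ z in 𝓝 x, z ∈ Q i →
      ∃ L : V →L[ℝ] F, ‖L‖ ≤ C ∧ HasFDerivWithinAt g L (Q i) z := by
    intro i
    by_cases hxi : x ∈ Q i
    · exact (hg i x hx hxi).eventually_hasFDerivWithinAt_norm_le hxi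
    · exact ⟨0, by filter_upwards [hclosed i x hx hxi] with z hz hz' using absurd hz' hz⟩
  choose C hC using h1
  -- The sum dominates every `C i`; the extra `1` absorbs the little-o remainder of the derivative.
  let K : ℝ≥0 := ∑ i, ‖C i‖₊ + 1
  have hCK : ∀ i, C i + 1 ≤ K := by
    intro i
    have : ‖C i‖₊ ≤ ∑ i, ‖C i‖₊ := Finset.single_le_sum (f := fun i => ‖C i‖₊)
      (fun _ _ => zero_le) (Finset.mem_univ i)
    have h2 : ‖C i‖ ≤ ((∑ i, ‖C i‖₊ : ℝ≥0) : ℝ) := by exact_mod_cast this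
    have h3 : (K : ℝ) = ((∑ i, ‖C i‖₊ : ℝ≥0) : ℝ) + 1 := by simp [K]
    rw [h3]
    linarith [Real.le_norm_self (C i)]
  have h2 : ∀ᶠ z in 𝓝 x, ∀ᶠ w in 𝓝 z, ‖g w - g z‖ ≤ K * ‖w - z‖ := by
    filter_upwards [eventually_all.2 hC, hU.mem_nhds hx] with z hz hzU
    have h3 : ∀ i, ∀ᶠ w in 𝓝 z, w ∈ Q i → ‖g w - g z‖ ≤ K * ‖w - z‖ := by
      intro i
      by_cases hzi : z ∈ Q i
      · obtain ⟨L, hL, hgL⟩ := hz i hzi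
        refine eventually_nhdsWithin_iff.1 ?_
        filter_upwards [hgL.isLittleO.bound zero_lt_one] with w hw
        have h4 : ‖g w - g z‖ ≤ ‖g w - g z - L (w - z)‖ + ‖L (w - z)‖ := norm_le_norm_sub_add _ _
        have h5 := L.le_of_opNorm_le hL (w - z)
        have h6 := mul_le_mul_of_nonneg_right (hCK i) (norm_nonneg (w - z))
        linarith
      · filter_upwards [hclosed i z hzU hzi] with w hw hw' using absurd hw' hw
    filter_upwards [eventually_all.2 h3, hU.mem_nhds hzU] with w hw hwU
    obtain ⟨i, hi⟩ := hcover w hwU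
    exact hw i hi
  obtain ⟨δ, hδ, hball⟩ := Metric.eventually_nhds_iff_ball.1 h2
  exact ⟨K, Metric.ball x δ, mem_nhdsWithin_of_mem_nhds (Metric.ball_mem_nhds x hδ),
    (convex_ball x δ).lipschitzOnWith_of_eventually_norm_sub_le hball⟩

/-- Compactness gives one constant on a thickening of the support. It serves as a pointwise bound
everywhere, and the whole space is convex. -/
theorem exists_lipschitzWith_of_locallyLipschitz {V F : Type*} [NormedAddCommGroup V]
    [NormedSpace ℝ V] [FiniteDimensional ℝ V] [NormedAddCommGroup F] {g : V → F}
    (hg : LocallyLipschitz g) (hc : HasCompactSupport g) : ∃ C, LipschitzWith C g := by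
  have : ProperSpace V := FiniteDimensional.proper_real V
  obtain ⟨C, hC⟩ := hg.locallyLipschitzOn.exists_lipschitzOnWith_of_compact
    (hc.isCompact.cthickening (r := 1))
  refine ⟨C, lipschitzOnWith_univ.1
    (convex_univ.lipschitzOnWith_of_eventually_norm_sub_le fun z _ => ?_)⟩
  by_cases hz : z ∈ tsupport g
  · have hn : Metric.cthickening 1 (tsupport g) ∈ 𝓝 z :=
      mem_of_superset (Metric.isOpen_thickening.mem_nhds
        (Metric.self_subset_thickening zero_lt_one _ hz)) (Metric.thickening_subset_cthickening _ _)
    filter_upwards [hn] with w hw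
    have := hC.dist_le_mul w hw z (mem_of_mem_nhds hn)
    simpa [dist_eq_norm] using this
  · have h0 := notMem_tsupport_iff_eventuallyEq.1 hz
    filter_upwards [h0] with w hw
    rw [hw, h0.eq_of_nhds]
    simpa using by positivity

variable {n k : ℕ} {M : Type*} [TopologicalSpace M] {F : Type*} [NormedAddCommGroup F]

/-- The coordinate expression of `f` in the chart `e`, extended by `0`. -/
noncomputable def chartExtension (e : OpenPartialHomeomorph M (Euc n)) (f : M → F) : Euc n → F :=
  e.target.indicator (f ∘ e.symm)

theorem chartExtension_eventuallyEq (e : OpenPartialHomeomorph M (Euc n)) (f : M → F) {u : Euc n}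
    (hu : u ∈ e.target) : chartExtension e f =ᶠ[𝓝 u] f ∘ e.symm := by
  filter_upwards [e.open_target.mem_nhds hu] with w hw
  exact indicator_of_mem hw _

theorem support_chartExtension_subset (e : OpenPartialHomeomorph M (Euc n)) (f : M → F) :
    support (chartExtension e f) ⊆ e.target ∩ e.symm ⁻¹' tsupport f := by
  intro u hu
  have hut : u ∈ e.target := by
    by_contra h
    exact hu (indicator_of_notMem h _)
  refine ⟨hut, subset_tsupport _ fun h => hu ?_⟩
  rw [chartExtension, indicator_of_mem hut]
  exact h

variable [ChartedSpace (Euc n) M] [NormedSpace ℝ F]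

theorem ContMDiffWithinAt.contDiffWithinAt_comp_symm [IsManifold (𝓡 n) ∞ M] {m : WithTop ℕ∞}
    [IsManifold (𝓡 n) m M] {f : M → F} {s : Set M}
    {e : OpenPartialHomeomorph M (Euc n)} (he : e ∈ atlas (Euc n) M) {u : Euc n} (hu : u ∈ e.target)
    (hf : ContMDiffWithinAt (𝓡 n) 𝓘(ℝ, F) m f s (e.symm u)) :
    ContDiffWithinAt ℝ m (f ∘ e.symm) (e.symm ⁻¹' s) u := by
  have := (contMDiffWithinAt_iff_source_of_mem_maximalAtlas
    (IsManifold.subset_maximalAtlas he) (e.map_target hu)).1 hf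
  simpa [e.right_inv hu] using this.contDiffWithinAt

theorem locallyLipschitzOn_comp_symm [IsManifold (𝓡 n) ∞ M] {P : Fin k → Set M}
    (hP : ∀ i, IsClosed (P i)) (hcover : ⋃ i, P i = univ) {f : M → F}
    (hf : ∀ i, ContMDiffOn (𝓡 n) 𝓘(ℝ, F) 1 f (P i)) {e : OpenPartialHomeomorph M (Euc n)}
    (he : e ∈ atlas (Euc n) M) : LocallyLipschitzOn e.target (f ∘ e.symm) := by
  have : IsManifold (𝓡 n) 1 M := IsManifold.of_le (n := ∞) (by norm_cast)
  refine locallyLipschitzOn_of_contDiffWithinAt e.open_target (Q := fun i => e.symm ⁻¹' P i)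
    (fun z _ => ?_) (fun i z hz hzi => ?_) (fun i z hz hzi => ?_)
  · have hz : e.symm z ∈ ⋃ i, P i := hcover ▸ mem_univ _
    obtain ⟨i, hi⟩ := mem_iUnion.1 hz
    exact ⟨i, hi⟩
  · exact (e.continuousAt_symm hz).preimage_mem_nhds ((hP i).isOpen_compl.mem_nhds hzi)
  · exact (hf i _ hzi).contDiffWithinAt_comp_symm he hz

/-- The support is compact inside the chart target, so extension by zero creates no jump. This moves
the problem to `ℝⁿ`, where mollification is available. -/
theorem exists_lipschitzWith_chartExtension [T2Space M] [CompactSpace M] [IsManifold (𝓡 n) ∞ M]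
    {P : Fin k → Set M} (hP : ∀ i, IsClosed (P i)) (hcover : ⋃ i, P i = univ) {f : M → F}
    (hf : ∀ i, ContMDiffOn (𝓡 n) 𝓘(ℝ, F) 1 f (P i)) {e : OpenPartialHomeomorph M (Euc n)}
    (he : e ∈ atlas (Euc n) M) (hs : tsupport f ⊆ e.source) :
    HasCompactSupport (chartExtension e f) ∧ tsupport (chartExtension e f) ⊆ e.target ∧
      ∃ C, LipschitzWith C (chartExtension e f) := by
  have hK : IsCompact (e '' tsupport f) :=
    (isClosed_tsupport f).isCompact.image_of_continuousOn (e.continuousOn.mono hs)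
  have hKt : e '' tsupport f ⊆ e.target := by
    rintro _ ⟨p, hp, rfl⟩
    exact e.map_source (hs hp)
  have hsub : support (chartExtension e f) ⊆ e '' tsupport f := fun u hu =>
    ⟨e.symm u, (support_chartExtension_subset e f hu).2,
      e.right_inv (support_chartExtension_subset e f hu).1⟩
  have hc : HasCompactSupport (chartExtension e f) :=
    HasCompactSupport.of_support_subset_isCompact hK hsub
  refine ⟨hc, (closure_minimal hsub hK.isClosed).trans hKt,
    exists_lipschitzWith_of_locallyLipschitz (fun u => ?_) hc⟩
  by_cases hu : u ∈ e.target
  · obtain ⟨C, t, ht, hL⟩ := locallyLipschitzOn_comp_symm hP hcover hf he hu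
    rw [e.open_target.nhdsWithin_eq hu] at ht
    refine ⟨C, t ∩ e.target, inter_mem ht (e.open_target.mem_nhds hu), ?_⟩
    intro a ha b hb
    rw [chartExtension, indicator_of_mem ha.2, indicator_of_mem hb.2]
    exact hL ha.1 hb.1
  · refine ⟨0, (e '' tsupport f)ᶜ, hK.isClosed.isOpen_compl.mem_nhds fun h => hu (hKt h), ?_⟩
    intro a ha b hb
    rw [notMem_support.1 fun h => ha (hsub h), notMem_support.1 fun h => hb (hsub h)]
    simp

/-! ### The boundaries of the pieces are null sets -/

/-- At a density point of `S`, the derivative of `h` is determined by the values on `S`, which are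
zero; so the derivative vanishes almost everywhere on `S`. No implicit function theorem is needed.
-/
theorem volume_eq_zero_of_fderiv_ne_zero (hn : 1 ≤ n) {h : Euc n → ℝ} {S : Set (Euc n)}
    (hS : MeasurableSet S) (h0 : ∀ x ∈ S, h x = 0) (hd : ∀ x ∈ S, fderiv ℝ h x ≠ 0) :
    volume S = 0 := by
  -- A unit vector turns `h` into a self-map of `ℝⁿ`, as the density-point result
  -- `ApproximatesLinearOn.norm_fderiv_sub_le` requires; `n ≥ 1` provides it.
  let v : Euc n := EuclideanSpace.single ⟨0, hn⟩ 1
  have hv : ‖v‖ = 1 := by simp [v]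
  have happ : ApproximatesLinearOn (fun x => h x • v) (0 : Euc n →L[ℝ] Euc n) S 0 := by
    intro x hx y hy
    simp [h0 x hx, h0 y hy]
  have hae := happ.norm_fderiv_sub_le volume hS (fun x => (fderiv ℝ h x).smulRight v) fun x hx => by
    have hdx : DifferentiableAt ℝ h x := by
      by_contra hnd
      exact hd x hx (fderiv_zero_of_not_differentiableAt hnd)
    exact (hdx.hasFDerivAt.smul_const v).hasFDerivWithinAt
  have hfalse : ∀ᵐ x ∂volume.restrict S, False := by
    filter_upwards [hae, ae_restrict_mem hS] with x hx hxS
    have hx' : ‖(fderiv ℝ h x).smulRight v‖ = 0 := by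
      have := le_antisymm hx zero_le
      rw [sub_zero] at this
      rw [← coe_nnnorm, this, NNReal.coe_zero]
    rw [ContinuousLinearMap.norm_smulRight_apply, hv, mul_one, norm_eq_zero] at hx'
    exact hd x hxS hx'
  simpa [ae_iff] using hfalse

variable [IsManifold (𝓡 n) ∞ M] [MeasurableSpace M] [BorelSpace M]

theorem IsSmoothFace.volume_image_chart [T2Space M] (hn : 1 ≤ n) {A : Set M} (hA : IsSmoothFace n A)
    {e : OpenPartialHomeomorph M (Euc n)} (he : e ∈ atlas (Euc n) M) :
    volume (e '' (A ∩ e.source)) = 0 := by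
  obtain ⟨hc, U, h, hU, hAU, hh, hp⟩ := hA
  have : IsManifold (𝓡 n) 1 M := IsManifold.of_le (n := ∞) (by simp)
  refine volume_eq_zero_of_fderiv_ne_zero hn (h := h ∘ e.symm)
    (measurableSet_image_chart e hc.measurableSet) ?_ ?_
  · rintro _ ⟨p, hpA, rfl⟩
    simp [e.left_inv hpA.2, (hp p hpA.1).1]
  · rintro _ ⟨p, hpA, rfl⟩ hzero
    refine (hp p hpA.1).2 ?_
    have hd : DifferentiableAt ℝ (h ∘ e.symm) (e p) := by
      have h1 : ContMDiffWithinAt (𝓡 n) 𝓘(ℝ, ℝ) 1 h U (e.symm (e p)) := by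
        rw [e.left_inv hpA.2]
        exact (hh p (hAU hpA.1)).of_le (by simp)
      have h2 := h1.contDiffWithinAt_comp_symm he (e.map_source hpA.2)
      refine (h2.contDiffAt ?_).differentiableAt one_ne_zero
      refine (e.continuousAt_symm (e.map_source hpA.2)).preimage_mem_nhds (hU.mem_nhds ?_)
      rw [e.left_inv hpA.2]
      exact hAU hpA.1
    have heq : h =ᶠ[𝓝 p] (h ∘ e.symm) ∘ e := by
      filter_upwards [e.open_source.mem_nhds hpA.2] with q hq
      simp [e.left_inv hq]
    rw [heq.mfderiv_eq, mfderiv_comp p (I' := 𝓡 n) hd.mdifferentiableAt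
      (mdifferentiableAt_atlas he hpA.2), mfderiv_eq_fderiv, hzero]
    exact ContinuousLinearMap.zero_comp _

theorem IsPiecewiseSmoothDomain.volume_image_chart_frontier [T2Space M] (hn : 1 ≤ n) {K : Set M}
    (hK : IsPiecewiseSmoothDomain n K) {e : OpenPartialHomeomorph M (Euc n)}
    (he : e ∈ atlas (Euc n) M) : volume (e '' (frontier K ∩ e.source)) = 0 := by
  obtain ⟨𝓕, hfin, hface, hK'⟩ := hK.faces
  rw [hK', sUnion_eq_biUnion, iUnion₂_inter, image_iUnion₂]
  exact (measure_biUnion_null_iff hfin.countable).2 fun A hA =>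
    (hface A hA).volume_image_chart hn he

/-- The induced volume is a supremum over a possibly uncountable atlas; by compactness finitely many
chart domains suffice. -/
theorem inducedVolume_eq_zero [CompactSpace M] (X : M → Euc (n + 1)) {S : Set M}
    (hS : MeasurableSet S) (h : ∀ e ∈ atlas (Euc n) M, volume (e '' (S ∩ e.source)) = 0) :
    inducedVolume X S = 0 := by
  obtain ⟨t, ht⟩ := isCompact_univ.elim_finite_subcover (fun x : M => (chartAt (Euc n) x).source)
    (fun x => (chartAt (Euc n) x).open_source)
    (fun x _ => mem_iUnion.2 ⟨x, mem_chart_source (Euc n) x⟩)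
  refine measure_mono_null (t := ⋃ x ∈ t, S ∩ (chartAt (Euc n) x).source) (fun p hp => ?_) ?_
  · obtain ⟨x, hx, hpx⟩ := mem_iUnion₂.1 (ht (mem_univ p))
    exact mem_iUnion₂.2 ⟨x, hx, hp, hpx⟩
  · refine (measure_biUnion_null_iff t.countable_toSet).2 fun x _ => ?_
    rw [← Measure.restrict_apply hS, inducedVolume_restrict_source X (chart_mem_atlas _ x),
      chartVolume_apply X _ hS]
    exact setLIntegral_measure_zero _ _ (h _ (chart_mem_atlas _ x))

end PiecewiseLipschitz

/-! ### Regularity of the Cahn–Hoffman map -/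

section CahnHoffmanRegularity

open Topology

variable {n : ℕ}

theorem contDiffAt_radialExtension {γ : USphere n → ℝ}
    (hγ : ContMDiff (𝓡 n) 𝓘(ℝ, ℝ) 2 γ) (ν : USphere n) :
    ContDiffAt ℝ 2 (radialExtension γ) (ν : Euc (n + 1)) := by
  have := Fact.mk (@finrank_euclideanSpace_fin ℝ _ (n + 1))
  let U : TopologicalSpace.Opens (Euc (n + 1)) := ⟨{x | x ≠ 0}, isOpen_ne⟩
  have hν : (ν : Euc (n + 1)) ≠ 0 := ne_zero_of_mem_unit_sphere ν
  let f : U → Euc (n + 1) := fun x => ‖(x : Euc (n + 1))‖⁻¹ • (x : Euc (n + 1))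
  have hf : ContMDiff 𝓘(ℝ, Euc (n + 1)) 𝓘(ℝ, Euc (n + 1)) 2 f := by
    intro x
    refine (contMDiffAt_subtype_iff (U := U)
      (f := fun x : Euc (n + 1) => ‖x‖⁻¹ • x)).2 (ContDiffAt.contMDiffAt ?_)
    have hx : (x : Euc (n + 1)) ≠ 0 := x.2
    exact ((contDiffAt_norm ℝ hx).inv (norm_ne_zero_iff.2 hx)).smul contDiffAt_id
  have hf' : ∀ x, f x ∈ Metric.sphere (0 : Euc (n + 1)) 1 := by
    intro x
    have hx : (x : Euc (n + 1)) ≠ 0 := x.2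
    simp [f, norm_smul, inv_mul_cancel₀ (norm_ne_zero_iff.2 hx)]
  have hN := hγ.comp (hf.codRestrict_sphere (n := n) hf')
  have key : ContMDiffAt 𝓘(ℝ, Euc (n + 1)) 𝓘(ℝ, ℝ) 2 (radialExtension γ) (ν : Euc (n + 1)) := by
    refine (contMDiffAt_subtype_iff (U := U) (f := radialExtension γ) (x := ⟨ν, hν⟩)).1 ?_
    convert! hN.contMDiffAt using 1
    ext x
    exact Subtype.val_injective.extend_apply γ 0 ⟨f x, hf' x⟩
  exact key.contDiffAt

/-- The Cahn–Hoffman map, extended to a neighbourhood of the sphere. -/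
noncomputable def cahnHoffmanExtension (γ : USphere n → ℝ) (x : Euc (n + 1)) : Euc (n + 1) :=
  gradient (radialExtension γ) x + radialExtension γ x • x

theorem cahnHoffmanExtension_coe (γ : USphere n → ℝ) (w : USphere n) :
    cahnHoffmanExtension γ (w : Euc (n + 1)) = cahnHoffman γ w := by
  rw [cahnHoffmanExtension, cahnHoffman, radialExtension_coe, sphereGradient]

theorem contDiffAt_cahnHoffmanExtension {γ : USphere n → ℝ}
    (hγ : ContMDiff (𝓡 n) 𝓘(ℝ, ℝ) 2 γ) (ν : USphere n) :
    ContDiffAt ℝ 1 (cahnHoffmanExtension γ) (ν : Euc (n + 1)) := by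
  have h := contDiffAt_radialExtension hγ ν
  refine ContDiffAt.add ?_ ((h.of_le (by norm_num)).smul contDiffAt_id)
  exact (InnerProductSpace.toDual ℝ (Euc (n + 1))).symm.contDiff.contDiffAt.comp _
    (h.fderiv_right (m := 1) (by norm_num))

theorem inner_cahnHoffman_self {γ : USphere n → ℝ}
    (hγ : ContMDiff (𝓡 n) 𝓘(ℝ, ℝ) 1 γ) (w : USphere n) :
    inner ℝ (cahnHoffman γ w) (w : Euc (n + 1)) = γ w := by
  rw [cahnHoffman, inner_add_left, inner_sphereGradient_self hγ, inner_smul_left,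
    real_inner_self_eq_norm_sq, norm_eq_of_mem_sphere w]
  simp

variable {M : Type*} [TopologicalSpace M] [ChartedSpace (Euc n) M]

theorem contMDiffOn_cahnHoffmanField {γ : USphere n → ℝ} (hγ : ContMDiff (𝓡 n) 𝓘(ℝ, ℝ) 2 γ)
    {ν : M → USphere n} {K : Set M} (hν : ContMDiffOn (𝓡 n) (𝓡 n) 1 ν K) :
    ContMDiffOn (𝓡 n) 𝓘(ℝ, Euc (n + 1)) 1 (cahnHoffmanField γ ν) K := by
  have := Fact.mk (@finrank_euclideanSpace_fin ℝ _ (n + 1))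
  intro p hp
  have h1 : ContMDiffWithinAt (𝓡 n) 𝓘(ℝ, Euc (n + 1)) 1 (fun q => (ν q : Euc (n + 1))) K p :=
    (contMDiff_coe_sphere (m := 1)).contMDiffAt.comp_contMDiffWithinAt p (hν p hp)
  have h2 := (contDiffAt_cahnHoffmanExtension hγ (ν p)).contMDiffAt.comp_contMDiffWithinAt
    (f := fun q => (ν q : Euc (n + 1))) p h1
  refine h2.congr (fun q _ => ?_) ?_ <;> exact (cahnHoffmanExtension_coe γ _).symm

/-- The differential of the Cahn–Hoffman field takes its values in `ν^⊥`. -/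
theorem inner_fderiv_cahnHoffman_eq_zero {γ : USphere n → ℝ}
    (hγ : ContMDiff (𝓡 n) 𝓘(ℝ, ℝ) 2 γ) {N : Euc n → USphere n} {u : Euc n}
    (hN : DifferentiableAt ℝ (fun w => (N w : Euc (n + 1))) u) (v : Euc n) :
    inner ℝ (fderiv ℝ (fun w => cahnHoffman γ (N w)) u v) (N u : Euc (n + 1)) = 0 := by
  have hγ1 : ContMDiff (𝓡 n) 𝓘(ℝ, ℝ) 1 γ := hγ.of_le (by norm_num)
  have hq := (differentiableAt_radialExtension hγ1 (N u)).hasFDerivAt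
  have hη : DifferentiableAt ℝ (fun w => cahnHoffman γ (N w)) u := by
    have h1 := ((contDiffAt_cahnHoffmanExtension hγ (N u)).differentiableAt one_ne_zero).comp
      (f := fun w => (N w : Euc (n + 1))) u hN
    refine h1.congr_of_eventuallyEq (Filter.Eventually.of_forall fun w => ?_)
    exact (cahnHoffmanExtension_coe γ (N w)).symm
  -- The function `γ(N) = ⟨ξ(N), N⟩` is differentiated in two ways, `h2` and `h3`. Since `⟨N, dN⟩ =
  -- 0`, the term `⟨ξ, dN⟩` equals `⟨Dγ, dN⟩ = d(γ ∘ N)`, which leaves `⟨dξ, N⟩ = 0`.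
  have h2 : HasFDerivAt (fun w => γ (N w)) _ u :=
    (hq.comp (f := fun w => (N w : Euc (n + 1))) u hN.hasFDerivAt).congr_of_eventuallyEq
      (Filter.Eventually.of_forall fun w => (radialExtension_coe γ (N w)).symm)
  have h3 : HasFDerivAt (fun w => γ (N w)) _ u :=
    (hη.hasFDerivAt.inner ℝ hN.hasFDerivAt).congr_of_eventuallyEq
      (Filter.Eventually.of_forall fun w => (inner_cahnHoffman_self hγ1 (N w)).symm)
  have h4 := DFunLike.congr_fun (h3.unique h2) v
  have h5 : HasFDerivAt (fun _ : Euc n => (1 : ℝ)) _ u :=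
    (hN.hasFDerivAt.inner ℝ hN.hasFDerivAt).congr_of_eventuallyEq
      (Filter.Eventually.of_forall fun w => by
        simp [norm_eq_of_mem_sphere (N w)])
  have h6 := DFunLike.congr_fun (h5.unique (hasFDerivAt_const _ _)) v
  simp only [ContinuousLinearMap.comp_apply, fderivInnerCLM_apply,
    ContinuousLinearMap.prod_apply, zero_apply] at h4 h6
  have h7 : inner ℝ (N u : Euc (n + 1)) (fderiv ℝ (fun w => (N w : Euc (n + 1))) u v) = 0 := by
    rw [real_inner_comm] at h6
    rw [real_inner_comm]
    linarith
  have h8 : inner ℝ (sphereGradient γ (N u)) (fderiv ℝ (fun w => (N w : Euc (n + 1))) u v) =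
      fderiv ℝ (radialExtension γ) (N u : Euc (n + 1))
        (fderiv ℝ (fun w => (N w : Euc (n + 1))) u v) := by
    rw [sphereGradient, gradient, InnerProductSpace.toDual_symm_apply]
  rw [cahnHoffman, inner_add_left, inner_smul_left, h7, h8] at h4
  linarith

end CahnHoffmanRegularity

/-! ### The volume form of `ℝⁿ⁺¹` -/

section VolumeForm

open Function

variable {n : ℕ}

/-- The standard volume form of `ℝⁿ⁺¹`. -/
noncomputable def volForm (d : ℕ) : Euc d [⋀^Fin d]→L[ℝ] ℝ where
  toMultilinearMap := (EuclideanSpace.basisFun (Fin d) ℝ).toBasis.det.toMultilinearMap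
  map_eq_zero_of_eq' := (EuclideanSpace.basisFun (Fin d) ℝ).toBasis.det.map_eq_zero_of_eq'
  cont := by
    change Continuous fun v : Fin d → Euc d => (EuclideanSpace.basisFun (Fin d) ℝ).toBasis.det v
    simp only [Module.Basis.det_apply]
    refine Continuous.matrix_det (continuous_matrix fun i j => ?_)
    simp only [Module.Basis.toMatrix_apply, OrthonormalBasis.coe_toBasis_repr_apply,
      EuclideanSpace.basisFun_repr]
    fun_prop

theorem volForm_apply {d : ℕ} (v : Fin d → Euc d) :
    volForm d v = (EuclideanSpace.basisFun (Fin d) ℝ).toBasis.det v := rfl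

theorem volForm_sq {d : ℕ} (v : Fin d → Euc d) : volForm d v ^ 2 = (Matrix.gram ℝ v).det := by
  have h : Matrix.gram ℝ v = ((EuclideanSpace.basisFun (Fin d) ℝ).toBasis.toMatrix v).transpose *
      (EuclideanSpace.basisFun (Fin d) ℝ).toBasis.toMatrix v := by
    ext i j
    simp [Matrix.gram_apply, Matrix.mul_apply, Module.Basis.toMatrix_apply, PiLp.inner_apply,
      mul_comm]
  rw [h, Matrix.det_mul, Matrix.det_transpose, volForm_apply, Module.Basis.det_apply, sq]

theorem det_gram_cons {d : ℕ} {N : Euc (n + 1)} (hN : ‖N‖ = 1) {v : Fin d → Euc (n + 1)}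
    (hv : ∀ j, inner ℝ N (v j) = 0) :
    (Matrix.gram ℝ (Fin.cons N v : Fin (d + 1) → Euc (n + 1))).det = (Matrix.gram ℝ v).det := by
  rw [Matrix.det_succ_row_zero, Fin.sum_univ_succ, Finset.sum_eq_zero]
  · simp [Matrix.gram_apply, hN]
    rfl
  · intro j _
    simp [Matrix.gram_apply, hv]

/-- Removing the normal component of `w` leaves `n + 1` vectors in the `n`-dimensional hyperplane
`N^⊥`, on which the volume form vanishes. -/
theorem volForm_cons_eq_inner_mul {N : Euc (n + 1)} (hN : ‖N‖ = 1) {v : Fin n → Euc (n + 1)}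
    (hv : ∀ j, inner ℝ N (v j) = 0) (w : Euc (n + 1)) :
    volForm (n + 1) (Fin.cons w v) = inner ℝ w N * volForm (n + 1) (Fin.cons N v) := by
  have hN0 : N ≠ 0 := by
    rintro rfl
    simp at hN
  have hfact : Fact (Module.finrank ℝ (Euc (n + 1)) = n + 1) := ⟨by simp⟩
  have h0 : volForm (n + 1) (Fin.cons (w - (inner ℝ w N : ℝ) • N) v) = 0 := by
    refine (volForm (n + 1)).toAlternatingMap.map_linearDependent _ fun hli => ?_
    have hle : Submodule.span ℝ (range (Fin.cons (w - (inner ℝ w N : ℝ) • N) v :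
        Fin (n + 1) → Euc (n + 1))) ≤ (Submodule.span ℝ {N})ᗮ := by
      rw [Submodule.span_le]
      rintro _ ⟨i, rfl⟩
      refine Submodule.mem_orthogonal_singleton_iff_inner_right.2 ?_
      refine Fin.cases ?_ (fun j => ?_) i
      · simp [inner_sub_right, inner_smul_right, hN, real_inner_comm]
      · simpa using hv j
    have h1 := Submodule.finrank_mono hle
    rw [finrank_span_eq_card hli, Fintype.card_fin,
      Submodule.finrank_orthogonal_span_singleton (n := n) hN0] at h1
    omega
  have h1 : ∀ a : Euc (n + 1), volForm (n + 1) (Fin.cons a v) =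
      volForm (n + 1) (update (Fin.cons N v) 0 a) := fun a => by rw [Fin.update_cons_zero]
  rw [h1, (volForm (n + 1)).map_update_sub, (volForm (n + 1)).map_update_smul, ← h1, ← h1,
    smul_eq_mul] at h0
  linarith

/-- With `w` fixed, `D(w, T·, …, T·)` is a form of top degree on `ℝⁿ`, hence a multiple of the
determinant. -/
theorem alternating_cons_comp {E : Type*} [NormedAddCommGroup E] [NormedSpace ℝ E]
    (D : E [⋀^Fin (n + 1)]→L[ℝ] ℝ) (w : E) (T : Euc n →ₗ[ℝ] E) (B : Euc n →ₗ[ℝ] Euc n) :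
    D (Fin.cons w fun j => T (B (EuclideanSpace.single j 1))) =
      LinearMap.det B * D (Fin.cons w fun j => T (EuclideanSpace.single j 1)) := by
  let e := (EuclideanSpace.basisFun (Fin n) ℝ).toBasis
  have he : ∀ j, e j = EuclideanSpace.single j (1 : ℝ) := fun j => by simp [e]
  let f : Euc n [⋀^Fin n]→ₗ[ℝ] ℝ := (D.toAlternatingMap.curryLeft w).compLinearMap T
  have hf : ∀ v, f v = D (Fin.cons w fun j => T (v j)) := fun v => rfl
  have h := congrArg (fun g => g (B ∘ e)) (f.eq_smul_basis_det e)
  simp only [AlternatingMap.smul_apply, Module.Basis.det_comp, Module.Basis.det_self, mul_one,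
    smul_eq_mul] at h
  rw [hf, hf] at h
  simp only [comp_apply, he] at h
  rw [h, mul_comm]

theorem hasDerivAt_alternating_cons {E : Type*} [NormedAddCommGroup E] [NormedSpace ℝ E]
    (D : E [⋀^Fin (n + 1)]→L[ℝ] ℝ) (y : E) (A B : Fin n → E) :
    HasDerivAt (fun s : ℝ => D (Fin.cons y (A + s • B)))
      (∑ j, D (Fin.cons y (update A j (B j)))) 0 := by
  let m : ℝ → Fin (n + 1) → E := fun s => Fin.cons y (A + s • B)
  have hd : ∀ i, Differentiable ℝ fun s => m s i := by
    refine fun i => Fin.cases ?_ (fun j => ?_) i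
    · simp [m]
    · simp only [m, Fin.cons_succ, Pi.add_apply, Pi.smul_apply]; fun_prop
  have h1 := fderiv_alternating_comp D (fun i => hd i 0) (1 : ℝ)
  have h2 : DifferentiableAt ℝ (fun s => D (m s)) 0 :=
    (D.toContinuousMultilinearMap.contDiff (n := 1)).differentiable one_ne_zero _ |>.comp 0
      (differentiableAt_pi.2 fun i => hd i 0)
  have h3 := h2.hasDerivAt
  rw [← fderiv_apply_one_eq_deriv, h1, Fin.sum_univ_succ] at h3
  convert! h3 using 1
  have h4 : ∀ j : Fin n, fderiv ℝ (fun s => m s j.succ) 0 1 = B j := by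
    intro j
    have : HasDerivAt (fun s => m s j.succ) (B j) 0 := by
      simpa [m] using ((hasDerivAt_id (0 : ℝ)).smul_const (B j)).const_add (A j)
    rw [fderiv_apply_one_eq_deriv, this.deriv]
  have h5 : m 0 = Fin.cons y A := by simp [m]
  rw [D.map_coord_zero 0 (by simp [m]), zero_add]
  refine Finset.sum_congr rfl fun j _ => ?_
  rw [h4, h5, Fin.cons_update]

/-- Writing the slotwise sum as a derivative in `s` reduces every computation with `variationForm`
to values `D(w, A + s B)`, which are determinants by `alternating_cons_comp`. -/
theorem variationForm_eq_sub_deriv {E : Type*} [NormedAddCommGroup E] [NormedSpace ℝ E]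
    (D : E [⋀^Fin (n + 1)]→L[ℝ] ℝ) (y z : E) (A B : Fin n → E) :
    variationForm D y z A B =
      n * D (Fin.cons z A) - deriv (fun s : ℝ => D (Fin.cons y (A + s • B))) 0 := by
  rw [(hasDerivAt_alternating_cons D y A B).deriv, variationForm]

/-- The integrand transforms under a change of coordinates as an `n`-form; apply
`alternating_cons_comp` to `T + s T'` for each `s`. -/
theorem variationForm_comp {E : Type*} [NormedAddCommGroup E] [NormedSpace ℝ E]
    (D : E [⋀^Fin (n + 1)]→L[ℝ] ℝ) (y z : E) (T T' : Euc n →ₗ[ℝ] E) (J : Euc n →ₗ[ℝ] Euc n) :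
    variationForm D y z (fun j => T (J (EuclideanSpace.single j 1)))
        (fun j => T' (J (EuclideanSpace.single j 1))) =
      LinearMap.det J * variationForm D y z (fun j => T (EuclideanSpace.single j 1))
        (fun j => T' (EuclideanSpace.single j 1)) := by
  rw [variationForm_eq_sub_deriv, variationForm_eq_sub_deriv, alternating_cons_comp]
  have h : ∀ s : ℝ, D (Fin.cons y ((fun j => T (J (EuclideanSpace.single j 1))) +
      s • fun j => T' (J (EuclideanSpace.single j 1)))) =
      LinearMap.det J * D (Fin.cons y ((fun j => T (EuclideanSpace.single j 1)) +
      s • fun j => T' (EuclideanSpace.single j 1))) := fun s =>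
    alternating_cons_comp D y (T + s • T') J
  simp only [h, deriv_const_mul_field]
  ring

end VolumeForm

/-! ### The variation integrand along anisotropic parallel hypersurfaces -/

section PointwiseFormula

open Function Topology

variable {n : ℕ}

theorem charpoly_coeff_sub (S : Euc n →ₗ[ℝ] Euc n) {r : ℕ} (hr : r ≤ n) :
    S.charpoly.coeff (n - r) =
      (-1) ^ r * (((S.charpoly.map (algebraMap ℝ ℂ)).roots.esymm r).re) := by
  have hdeg : (S.charpoly.map (algebraMap ℝ ℂ)).natDegree = n := by
    rw [(LinearMap.charpoly_monic S).natDegree_map, LinearMap.charpoly_natDegree]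
    simp
  have hm : (S.charpoly.map (algebraMap ℝ ℂ)).Monic := (LinearMap.charpoly_monic _).map _
  have h := Polynomial.coeff_eq_esymm_roots_of_splits
    (IsAlgClosed.splits (S.charpoly.map (algebraMap ℝ ℂ)))
    (k := n - r) (by rw [hdeg]; exact Nat.sub_le _ _)
  rw [hm.leadingCoeff, one_mul, hdeg, Nat.sub_sub_self hr, Polynomial.coeff_map] at h
  have h2 := congrArg Complex.re h
  have h3 : ((-1 : ℂ) ^ r) = (((-1 : ℝ) ^ r : ℝ) : ℂ) := by push_cast; rfl
  rw [h3, Complex.re_ofReal_mul] at h2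
  exact h2

/-- The determinant is `t ^ n` times the characteristic polynomial at `σ / t`, expanded by Vieta.
The parameter `σ` is kept free so that it can be differentiated at `σ = 1`. -/
theorem det_sub_smul (S : Euc n →ₗ[ℝ] Euc n) (σ : ℝ) {t : ℝ} (ht : t ≠ 0) :
    LinearMap.det (σ • LinearMap.id - t • S) = ∑ r ∈ Finset.range (n + 1),
      (-t) ^ r * σ ^ (n - r) * ((S.charpoly.map (algebraMap ℝ ℂ)).roots.esymm r).re := by
  have h1 : σ • LinearMap.id - t • S =
      t • (algebraMap ℝ (Module.End ℝ (Euc n)) (σ / t) - S) := by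
    rw [smul_sub, Algebra.algebraMap_eq_smul_one, smul_smul, mul_div_cancel₀ _ ht]
    rfl
  rw [h1, LinearMap.det_smul, ← LinearMap.eval_charpoly, Polynomial.eval_eq_sum_range,
    LinearMap.charpoly_natDegree, ← Finset.sum_range_reflect, Finset.mul_sum]
  simp only [finrank_euclideanSpace, Fintype.card_fin]
  refine Finset.sum_congr rfl fun r hr => ?_
  have hr' : r ≤ n := Nat.lt_succ_iff.1 (Finset.mem_range.1 hr)
  rw [show n + 1 - 1 - r = n - r by omega, charpoly_coeff_sub S hr', div_pow]
  have h2 : t ^ n = t ^ r * t ^ (n - r) := by rw [← pow_add, Nat.add_sub_cancel' hr']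
  rw [h2, neg_pow t r]
  field_simp

/-- Splitting `n - r` cancels the terms with factor `n x`. What is left of the `x` part carries the
factor `r`; shifting its index pairs `c (r + 1)` with `c r` and brings out the common factor `-t`.
It reflects that the integrand is trivially zero at `t = 0`, where both maps are `X`. -/
theorem sum_variation_identity (c : ℕ → ℝ) (x g t : ℝ) :
    n * x * ∑ r ∈ Finset.range (n + 1), (-t) ^ r * c r -
        (x + t * g) * ∑ r ∈ Finset.range (n + 1), (-t) ^ r * (n - r : ℕ) * c r =
      -t * ∑ r ∈ Finset.range n,
        (-t) ^ r * (g * ((n - r : ℕ) * c r) + x * ((r + 1) * c (r + 1))) := by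
  have h1 : ∑ r ∈ Finset.range (n + 1), (-t) ^ r * (n - r : ℕ) * c r =
      n * ∑ r ∈ Finset.range (n + 1), (-t) ^ r * c r -
        ∑ r ∈ Finset.range (n + 1), r * ((-t) ^ r * c r) := by
    rw [Finset.mul_sum, ← Finset.sum_sub_distrib]
    refine Finset.sum_congr rfl fun r hr => ?_
    rw [Nat.cast_sub (Nat.lt_succ_iff.1 (Finset.mem_range.1 hr))]
    ring
  have h2 : ∑ r ∈ Finset.range (n + 1), r * ((-t) ^ r * c r) =
      -t * ∑ r ∈ Finset.range n, (-t) ^ r * ((r + 1) * c (r + 1)) := by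
    rw [Finset.sum_range_succ', Finset.mul_sum]
    simp only [Nat.cast_zero, zero_mul, add_zero]
    refine Finset.sum_congr rfl fun r _ => ?_
    push_cast
    ring
  have h3 : ∑ r ∈ Finset.range (n + 1), (-t) ^ r * (n - r : ℕ) * c r =
      ∑ r ∈ Finset.range n, (-t) ^ r * (n - r : ℕ) * c r := by
    rw [Finset.sum_range_succ]
    simp
  have h4 : ∑ r ∈ Finset.range n,
      (-t) ^ r * (g * ((n - r : ℕ) * c r) + x * ((r + 1) * c (r + 1))) =
      g * ∑ r ∈ Finset.range n, (-t) ^ r * (n - r : ℕ) * c r +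
        x * ∑ r ∈ Finset.range n, (-t) ^ r * ((r + 1) * c (r + 1)) := by
    rw [Finset.mul_sum, Finset.mul_sum, ← Finset.sum_add_distrib]
    refine Finset.sum_congr rfl fun r _ => ?_
    ring
  rw [h4, ← h3]
  linear_combination (-x) * h1 + x * h2

/-- The variation integrand of `X` along the parallel hypersurface `X + t ξ`, in terms of the
anisotropic shape operator. -/
theorem variationForm_parallel {N x ξ : Euc (n + 1)} (hN : ‖N‖ = 1) {T T' : Euc n →ₗ[ℝ] Euc (n + 1)}
    (hT : ∀ v, inner ℝ N (T v) = 0) {S : Euc n →ₗ[ℝ] Euc n} (hS : ∀ v, T (S v) = -T' v) {t : ℝ}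
    (ht : t ≠ 0) {c : ℕ → ℝ}
    (hc : ∀ r, c r = ((S.charpoly.map (algebraMap ℝ ℂ)).roots.esymm r).re) :
    variationForm (volForm (n + 1)) (x + t • ξ) x
        (fun j => T (EuclideanSpace.single j 1) + t • T' (EuclideanSpace.single j 1))
        (fun j => T (EuclideanSpace.single j 1)) =
      (-t * ∑ r ∈ Finset.range n, (-t) ^ r * (inner ℝ ξ N * ((n - r : ℕ) * c r) +
        inner ℝ x N * ((r + 1) * c (r + 1)))) *
        volForm (n + 1) (Fin.cons N fun j => T (EuclideanSpace.single j 1)) := by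
  set V := volForm (n + 1) (Fin.cons N fun j => T (EuclideanSpace.single j 1)) with hV
  -- Since `T' = -T ∘ S`, the map `T + t T' + s T` is `T ∘ ((1 + s) - t S)`.
  have key : ∀ (w : Euc (n + 1)) (s : ℝ), volForm (n + 1) (Fin.cons w
      ((fun j => T (EuclideanSpace.single j 1) + t • T' (EuclideanSpace.single j 1)) +
        s • fun j => T (EuclideanSpace.single j 1))) =
      (∑ r ∈ Finset.range (n + 1), (-t) ^ r * (1 + s) ^ (n - r) * c r) * (inner ℝ w N * V) := by
    intro w s
    have h1 : ((fun j => T (EuclideanSpace.single j 1) + t • T' (EuclideanSpace.single j 1)) +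
        s • fun j => T (EuclideanSpace.single j 1)) =
        fun j => T (((1 + s) • LinearMap.id - t • S : Euc n →ₗ[ℝ] Euc n) (EuclideanSpace.single j 1)) := by
      funext j
      simp only [Pi.add_apply, Pi.smul_apply, LinearMap.sub_apply, LinearMap.smul_apply,
        LinearMap.id_apply, map_sub, map_smul, hS, smul_neg]
      rw [add_smul, one_smul]
      abel
    rw [h1, alternating_cons_comp, det_sub_smul S _ ht,
      volForm_cons_eq_inner_mul hN (fun j => hT _) w]
    simp only [hc, hV]
  have h0 := key x 0
  rw [zero_smul, add_zero] at h0
  have hder : HasDerivAt (fun s : ℝ => ∑ r ∈ Finset.range (n + 1),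
      (-t) ^ r * (1 + s) ^ (n - r) * c r)
      (∑ r ∈ Finset.range (n + 1), (-t) ^ r * (n - r : ℕ) * c r) 0 := by
    refine HasDerivAt.fun_sum fun r _ => ?_
    have := ((((hasDerivAt_id (0 : ℝ)).const_add 1).pow (n - r)).const_mul ((-t) ^ r)).mul_const
      (c r)
    simpa using this
  rw [variationForm_eq_sub_deriv, h0]
  simp only [key]
  rw [(hder.mul_const _).deriv, inner_add_left, inner_smul_left]
  have := sum_variation_identity (n := n) c (inner ℝ x N) (inner ℝ ξ N) t
  simp only [add_zero, one_pow, mul_one, conj_trivial]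
  linear_combination V * this

variable {M : Type*} [TopologicalSpace M] [ChartedSpace (Euc n) M]

theorem diffAt_apply {f : M → Euc (n + 1)} {p : M}
    (hf : MDifferentiableAt (𝓡 n) 𝓘(ℝ, Euc (n + 1)) f p) (v : Euc n) :
    diffAt f p v = fderiv ℝ (f ∘ (chartAt (Euc n) p).symm) (chartAt (Euc n) p p) v := by
  rw [diffAt, hf.mfderiv]
  simp [writtenInExtChartAt, fderivWithin_univ]
  rfl

theorem ContMDiffOn.differentiableAt_comp_symm [IsManifold (𝓡 n) ∞ M] {F : Type*}
    [NormedAddCommGroup F] [NormedSpace ℝ F] {f : M → F} {K : Set M}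
    (hf : ContMDiffOn (𝓡 n) 𝓘(ℝ, F) 1 f K) {e : OpenPartialHomeomorph M (Euc n)}
    (he : e ∈ atlas (Euc n) M) {p : M} (hp : p ∈ interior K) (hpe : p ∈ e.source) :
    DifferentiableAt ℝ (f ∘ e.symm) (e p) := by
  have : IsManifold (𝓡 n) 1 M := IsManifold.of_le (n := ∞) (by simp)
  have h1 : ContMDiffWithinAt (𝓡 n) 𝓘(ℝ, F) 1 f K (e.symm (e p)) := by
    rw [e.left_inv hpe]
    exact hf p (interior_subset hp)
  refine ((h1.contDiffWithinAt_comp_symm he (e.map_source hpe)).contDiffAt ?_).differentiableAt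
    one_ne_zero
  refine (e.continuousAt_symm (e.map_source hpe)).preimage_mem_nhds ?_
  rw [e.left_inv hpe]
  exact mem_interior_iff_mem_nhds.1 hp

theorem coe_tangentialDiff {f : M → Euc (n + 1)} {w : Euc (n + 1)} {p : M}
    {v : TangentSpace (𝓡 n) p} (h : inner ℝ w (diffAt f p v) = 0) :
    (tangentialDiff f w p v : Euc (n + 1)) = diffAt f p v :=
  Submodule.starProjection_eq_self_iff.2 (Submodule.mem_orthogonal_singleton_iff_inner_right.2 h)

theorem mdifferentiableAt_of_mem_interior {f : M → Euc (n + 1)} {K : Set M}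
    (hf : ContMDiffOn (𝓡 n) 𝓘(ℝ, Euc (n + 1)) 1 f K) {p : M} (hp : p ∈ interior K) :
    MDifferentiableAt (𝓡 n) 𝓘(ℝ, Euc (n + 1)) f p :=
  (hf.contMDiffAt (mem_interior_iff_mem_nhds.1 hp)).mdifferentiableAt one_ne_zero

variable {k : ℕ} {P : Fin k → Set M} {X : M → Euc (n + 1)} {ν : Fin k → M → USphere n}

theorem IsPiecewiseWeakImmersion.contMDiffOn_one (hX : IsPiecewiseWeakImmersion 2 P X ν)
    (i : Fin k) : ContMDiffOn (𝓡 n) 𝓘(ℝ, Euc (n + 1)) 1 X (P i) :=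
  (hX.contMDiffOn i).of_le (by norm_num)

theorem IsPiecewiseWeakImmersion.normal_contMDiffOn_one (hX : IsPiecewiseWeakImmersion 2 P X ν)
    (i : Fin k) : ContMDiffOn (𝓡 n) (𝓡 n) 1 (ν i) (P i) := by
  simpa using hX.normal_contMDiffOn i

theorem IsPiecewiseWeakImmersion.inner_fderiv (hX : IsPiecewiseWeakImmersion 2 P X ν) {i : Fin k}
    {p : M} (hp : p ∈ interior (P i)) (v : Euc n) :
    inner ℝ (ν i p : Euc (n + 1))
      (fderiv ℝ (X ∘ (chartAt (Euc n) p).symm) (chartAt (Euc n) p p) v) = 0 := by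
  have hd := mdifferentiableAt_of_mem_interior (hX.contMDiffOn_one i) hp
  rw [← diffAt_apply hd v]
  exact hX.normal i p hp v

/-- The unit vector `ν` is orthogonal to the `∂ᵢX`, so the square of the determinant is the Gram
determinant of the `∂ᵢX`; the orientation selects the positive root. -/
theorem IsPiecewiseWeakImmersion.volumeDensity_chartAt (hX : IsPiecewiseWeakImmersion 2 P X ν)
    {i : Fin k} {p : M} (hp : p ∈ interior (P i)) :
    volForm (n + 1) (Fin.cons (ν i p : Euc (n + 1))
      (chartPartial X (chartAt (Euc n) p) (chartAt (Euc n) p p))) =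
        volumeDensity X (chartAt (Euc n) p) (chartAt (Euc n) p p) ∧
      0 < volumeDensity X (chartAt (Euc n) p) (chartAt (Euc n) p p) := by
  have hpos : 0 < volForm (n + 1) (Fin.cons (ν i p : Euc (n + 1))
      (chartPartial X (chartAt (Euc n) p) (chartAt (Euc n) p p))) :=
    hX.orientation i p hp _ (chart_mem_atlas _ p) (mem_chart_source _ p)
  have heq : volForm (n + 1) (Fin.cons (ν i p : Euc (n + 1))
      (chartPartial X (chartAt (Euc n) p) (chartAt (Euc n) p p))) =
        volumeDensity X (chartAt (Euc n) p) (chartAt (Euc n) p p) := by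
    rw [volumeDensity, ← det_gram_cons (norm_eq_of_mem_sphere (ν i p))
      (v := chartPartial X (chartAt (Euc n) p) (chartAt (Euc n) p p))
      (fun j => hX.inner_fderiv hp _), ← volForm_sq, Real.sqrt_sq hpos.le]
  exact ⟨heq, heq ▸ hpos⟩

/-- The variation integrand of `X` along `X + t ξ̃` is a combination of the integrands
`γ(ν) H_r + ⟨X, ν⟩ H_{r+1}`. -/
theorem IsPiecewiseWeakImmersion.variationForm_chartAt [IsManifold (𝓡 n) ∞ M]
    (hX : IsPiecewiseWeakImmersion 2 P X ν) {γ : USphere n → ℝ}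
    (hγ : ContMDiff (𝓡 n) 𝓘(ℝ, ℝ) 2 γ) {Ξ : M → Euc (n + 1)} {i : Fin k} {p : M}
    (hp : p ∈ interior (P i)) (hΞ : Ξ =ᶠ[𝓝 p] cahnHoffmanField γ (ν i)) {t : ℝ} (ht : t ≠ 0) :
    variationForm (volForm (n + 1)) (X p + t • Ξ p) (X p)
        (chartPartial (fun q => X q + t • Ξ q) (chartAt (Euc n) p) (chartAt (Euc n) p p))
        (chartPartial X (chartAt (Euc n) p) (chartAt (Euc n) p p)) =
      (-t * ∑ r ∈ Finset.range n, (-t) ^ r * ((n - r : ℕ) * n.choose r) *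
        (γ (ν i p) * anisotropicMeanCurvature γ X (ν i) r p +
          inner ℝ (X p) (ν i p : Euc (n + 1)) * anisotropicMeanCurvature γ X (ν i) (r + 1) p)) *
        volumeDensity X (chartAt (Euc n) p) (chartAt (Euc n) p p) := by
  have := Fact.mk (@finrank_euclideanSpace_fin ℝ _ (n + 1))
  have hs := mem_chart_source (Euc n) p
  have hat := chart_mem_atlas (Euc n) p
  set e := chartAt (Euc n) p with he
  have hXd := (hX.contMDiffOn_one i).differentiableAt_comp_symm hat hp hs
  have hξ := contMDiffOn_cahnHoffmanField hγ (hX.normal_contMDiffOn_one i)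
  have hξd := hξ.differentiableAt_comp_symm hat hp hs
  have hνd : DifferentiableAt ℝ (fun w => (ν i (e.symm w) : Euc (n + 1))) (e p) := by
    have h1 : ContMDiffOn (𝓡 n) 𝓘(ℝ, Euc (n + 1)) 1 (fun q => (ν i q : Euc (n + 1))) (P i) :=
      (contMDiff_coe_sphere (m := 1)).comp_contMDiffOn (hX.normal_contMDiffOn_one i)
    exact h1.differentiableAt_comp_symm hat hp hs
  have hΞe : Ξ ∘ e.symm =ᶠ[𝓝 (e p)] cahnHoffmanField γ (ν i) ∘ e.symm := by
    have h1 : Filter.Tendsto e.symm (𝓝 (e p)) (𝓝 p) := by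
      have := (e.continuousAt_symm (e.map_source hs)).tendsto
      rwa [e.left_inv hs] at this
    exact h1.eventually hΞ
  have hΞd : DifferentiableAt ℝ (Ξ ∘ e.symm) (e p) := hξd.congr_of_eventuallyEq hΞe
  have hdξ : ∀ v, diffAt (cahnHoffmanField γ (ν i)) p v =
      fderiv ℝ (Ξ ∘ e.symm) (e p) v := fun v => by
    rw [hΞe.fderiv_eq]
    exact diffAt_apply (mdifferentiableAt_of_mem_interior hξ hp) v
  have hdX : ∀ v, diffAt X p v = fderiv ℝ (X ∘ e.symm) (e p) v :=
    diffAt_apply (mdifferentiableAt_of_mem_interior (hX.contMDiffOn_one i) hp)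
  have horth : ∀ v, inner ℝ (ν i p : Euc (n + 1)) (fderiv ℝ (Ξ ∘ e.symm) (e p) v) = 0 := by
    intro v
    rw [hΞe.fderiv_eq, real_inner_comm]
    have := inner_fderiv_cahnHoffman_eq_zero hγ hνd v
    rw [e.left_inv hs] at this
    exact this
  have horth' : ∀ v, inner ℝ (ν i p : Euc (n + 1)) (diffAt (cahnHoffmanField γ (ν i)) p v) = 0 :=
    fun v => by
      rw [hdξ]
      exact horth v
  -- The projections in the definition of the shape operator disappear because `dX` and `dξ̃` both
  -- take values in `ν^⊥`.
  have hS : ∀ v, fderiv ℝ (X ∘ e.symm) (e p) (anisotropicShapeOperator γ X (ν i) p v) =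
      -fderiv ℝ (Ξ ∘ e.symm) (e p) v := by
    intro v
    have h1 := congrArg (Subtype.val) (tangentialDiff_anisotropicShapeOperator γ X (ν i) p
      (hX.immersion i p hp) (hX.normal i p hp) v)
    have h2 := coe_tangentialDiff (hX.normal i p hp (anisotropicShapeOperator γ X (ν i) p v))
    have h3 := coe_tangentialDiff (f := cahnHoffmanField γ (ν i)) (w := (ν i p : Euc (n + 1)))
      (p := p) (v := v) (horth' v)
    exact (hdX _).symm.trans (h2.symm.trans (h1.trans (congrArg Neg.neg (h3.trans (hdξ v)))))
  have hA : chartPartial (fun q => X q + t • Ξ q) e (e p) = fun j =>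
      fderiv ℝ (X ∘ e.symm) (e p) (EuclideanSpace.single j 1) +
        t • fderiv ℝ (Ξ ∘ e.symm) (e p) (EuclideanSpace.single j 1) := by
    funext j
    have h1 : fderiv ℝ ((fun q => X q + t • Ξ q) ∘ e.symm) (e p) =
        fderiv ℝ (X ∘ e.symm) (e p) + t • fderiv ℝ (Ξ ∘ e.symm) (e p) :=
      (hXd.hasFDerivAt.add (hΞd.hasFDerivAt.const_smul t)).fderiv
    rw [chartPartial, h1]
    rfl
  have key := variationForm_parallel (N := (ν i p : Euc (n + 1))) (x := X p) (ξ := Ξ p)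
    (norm_eq_of_mem_sphere (ν i p))
    (T := (fderiv ℝ (X ∘ e.symm) (e p)).toLinearMap)
    (T' := (fderiv ℝ (Ξ ∘ e.symm) (e p)).toLinearMap)
    (fun v => hX.inner_fderiv hp v) hS ht (c := fun r =>
      ((anisotropicPrincipalCurvatures γ X (ν i) p).esymm r).re) (fun _ => rfl)
  rw [hA]
  refine key.trans ?_
  rw [← (hX.volumeDensity_chartAt hp).1, hΞ.eq_of_nhds, cahnHoffmanField,
    inner_cahnHoffman_self (hγ.of_le (by norm_num))]
  refine congrArg₂ (· * ·) (congrArg (-t * ·) (Finset.sum_congr rfl fun r hr => ?_)) rfl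
  have hr' := Finset.mem_range.1 hr
  have h1 : (n.choose r : ℝ) ≠ 0 := by exact_mod_cast (Nat.choose_pos hr'.le).ne'
  have h2 : (n.choose (r + 1) : ℝ) ≠ 0 := by exact_mod_cast (Nat.choose_pos hr').ne'
  -- This identity gives `H_r` and `H_{r+1}` the same weight `(n - r) (n choose r)`.
  have h3 : (n.choose (r + 1) : ℝ) * (r + 1) = n.choose r * (n - r : ℕ) := by
    exact_mod_cast Nat.choose_succ_right_eq n r
  simp only [anisotropicMeanCurvature]
  have h4 : ((n - r : ℕ) : ℝ) * n.choose r = n.choose (r + 1) * (r + 1) := by rw [h3, mul_comm]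
  rw [mul_add, mul_add]
  congr 1
  · field_simp
  · rw [h4]
    field_simp

end PointwiseFormula

/-! ### Integration against the induced volume; finiteness of the area -/

section ChartIntegral

open Filter Topology Function
open scoped NNReal

variable {n : ℕ} {M : Type*} [TopologicalSpace M]

theorem continuous_sqrt_det_gram {E : Type*} [NormedAddCommGroup E] [InnerProductSpace ℝ E] :
    Continuous fun v : Fin n → E => √(Matrix.gram ℝ v).det := by
  refine Real.continuous_sqrt.comp (Continuous.matrix_det (continuous_matrix fun i j => ?_))
  simp only [Matrix.gram_apply]
  fun_prop

theorem measurable_volumeDensity (X : M → Euc (n + 1)) (e : OpenPartialHomeomorph M (Euc n)) :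
    Measurable (volumeDensity X e) :=
  continuous_sqrt_det_gram.measurable.comp
    (measurable_pi_lambda _ fun _ => measurable_fderiv_apply_const ℝ _ _)

theorem volumeDensity_nonneg (X : M → Euc (n + 1)) (e : OpenPartialHomeomorph M (Euc n))
    (u : Euc n) : 0 ≤ volumeDensity X e u :=
  Real.sqrt_nonneg _

/-- Used both for Lebesgue-null exceptional sets and for the set where the density vanishes. -/
theorem chartVolume_inter_preimage_eq_zero [MeasurableSpace M] [BorelSpace M] (X : M → Euc (n + 1))
    (e : OpenPartialHomeomorph M (Euc n)) {T : Set (Euc n)} (hT : MeasurableSet T)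
    (h : ∀ᵐ u, u ∈ T → volumeDensity X e u = 0) :
    chartVolume X e (e.source ∩ e ⁻¹' T) = 0 := by
  classical
  have hpw : Measurable (e.source.piecewise e fun _ => 0) :=
    ContinuousOn.measurable_piecewise e.continuousOn continuousOn_const e.open_source.measurableSet
  have hS : MeasurableSet (e.source ∩ e ⁻¹' T) := by
    have h1 : e.source ∩ e ⁻¹' T = e.source ∩ (e.source.piecewise e fun _ => 0) ⁻¹' T := by
      ext p
      simp only [mem_inter_iff, mem_preimage, and_congr_right_iff]
      intro hp
      rw [piecewise_eq_of_mem _ _ _ hp]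
    rw [h1]
    exact e.open_source.measurableSet.inter (hpw hT)
  rw [chartVolume_apply X e hS]
  refine (setLIntegral_congr_fun_ae (measurableSet_image_chart e hS) ?_).trans
    (lintegral_zero (μ := volume.restrict _))
  filter_upwards [h] with u hu
  rintro ⟨p, ⟨⟨-, hp⟩, -⟩, rfl⟩
  rw [hu hp, ENNReal.ofReal_zero]

variable [ChartedSpace (Euc n) M] [IsManifold (𝓡 n) ∞ M] [MeasurableSpace M] [BorelSpace M]

/-- Integration against the induced volume on the domain of a chart. -/
theorem setIntegral_source_inducedVolume (X : M → Euc (n + 1))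
    {e : OpenPartialHomeomorph M (Euc n)} (he : e ∈ atlas (Euc n) M) {g : M → ℝ} {w : Euc n → ℝ}
    (hw : Integrable w)
    (h : ∀ᵐ u, u ∈ e.target → w u = g (e.symm u) * volumeDensity X e u) :
    IntegrableOn g e.source (inducedVolume X) ∧
      ∫ p in e.source, g p ∂(inducedVolume X) = ∫ u in e.target, w u := by
  have hvm := measurable_volumeDensity X e
  have hρm : Measurable fun u => ENNReal.ofReal (volumeDensity X e u) := hvm.ennreal_ofReal
  classical
  have hpw : Measurable (e.source.piecewise e fun _ => 0) :=
    ContinuousOn.measurable_piecewise e.continuousOn continuousOn_const e.open_source.measurableSet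
  -- No measurability of `g` is assumed. It is recovered as `w' / volumeDensity`, with `w'` a
  -- measurable representative of `w`; the exceptional set `T` and the zeros of the density are null
  -- for the induced volume.
  obtain ⟨w', hw'm, hww'⟩ := hw.1
  have hbad : ∀ᵐ u, u ∈ e.target → w' u = g (e.symm u) * volumeDensity X e u := by
    filter_upwards [h, hww'] with u h1 h2 hu
    rw [← h2, h1 hu]
  obtain ⟨T, hTsub, hTm, hT0⟩ := exists_measurable_superset_of_null (ae_iff.1 hbad)
  have hTae : ∀ᵐ u, u ∈ T → volumeDensity X e u = 0 := by
    filter_upwards [measure_eq_zero_iff_ae_notMem.1 hT0] with u hu hu' using absurd hu' hu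
  have hN1 := chartVolume_inter_preimage_eq_zero X e hTm hTae
  have hN2 := chartVolume_inter_preimage_eq_zero X e (T := {u | volumeDensity X e u = 0})
    (hvm (measurableSet_singleton 0)) (Eventually.of_forall fun u hu => hu)
  have hg : AEStronglyMeasurable g (chartVolume X e) := by
    refine ⟨fun p => w' (e.source.piecewise e (fun _ => 0) p) /
      volumeDensity X e (e.source.piecewise e (fun _ => 0) p), ?_, ?_⟩
    · exact ((hw'm.measurable.comp hpw).div (hvm.comp hpw)).stronglyMeasurable
    · filter_upwards [measure_eq_zero_iff_ae_notMem.1 hN1, measure_eq_zero_iff_ae_notMem.1 hN2,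
        measure_eq_zero_iff_ae_notMem.1 (chartVolume_compl_source X e)] with p h1 h2 h3
      have hp : p ∈ e.source := not_notMem.1 h3
      rw [piecewise_eq_of_mem _ _ _ hp]
      have h4 : volumeDensity X e (e p) ≠ 0 := fun h0 => h2 ⟨hp, h0⟩
      have h5 : e p ∉ T := fun h0 => h1 ⟨hp, h0⟩
      have h6 : w' (e p) = g (e.symm (e p)) * volumeDensity X e (e p) := by
        by_contra h0
        exact h5 (hTsub fun h7 => h0 (h7 (e.map_source hp)))
      rw [e.left_inv hp] at h6
      rw [h6, mul_div_cancel_right₀ _ h4]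
  have hm : AEMeasurable e.symm ((volume.restrict e.target).withDensity
      fun u => ENNReal.ofReal (volumeDensity X e u)) :=
    (e.continuousOn_symm.aemeasurable e.open_target.measurableSet).mono_ac
      (withDensity_absolutelyContinuous _ _)
  have hae : (fun u => (ENNReal.ofReal (volumeDensity X e u)).toReal • g (e.symm u))
      =ᵐ[volume.restrict e.target] w := by
    filter_upwards [ae_restrict_of_ae h, ae_restrict_mem e.open_target.measurableSet] with u h1 h2
    rw [h1 h2, ENNReal.toReal_ofReal (volumeDensity_nonneg X e u), smul_eq_mul, mul_comm]
  have hfin : ∀ᵐ u ∂(volume.restrict e.target), ENNReal.ofReal (volumeDensity X e u) < ⊤ :=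
    Eventually.of_forall fun _ => ENNReal.ofReal_lt_top
  rw [IntegrableOn, inducedVolume_restrict_source X he]
  rw [chartVolume] at hg ⊢
  constructor
  · rw [integrable_map_measure hg hm, integrable_withDensity_iff_integrable_smul' hρm hfin]
    exact (integrable_congr hae).2 hw.integrableOn
  · rw [integral_map hm hg, integral_withDensity_eq_integral_toReal_smul hρm hfin]
    exact integral_congr_ae hae

/-- A local Lipschitz bound controls the coordinate derivatives, hence the Gram determinant, so each
point has a neighbourhood of finite volume. -/
theorem isFiniteMeasure_inducedVolume [CompactSpace M] {X : M → Euc (n + 1)}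
    (hX : ∀ e ∈ atlas (Euc n) M, LocallyLipschitzOn e.target (X ∘ e.symm)) :
    IsFiniteMeasure (inducedVolume X) := by
  refine ⟨isCompact_univ.measure_lt_top_of_nhdsWithin fun p _ => ?_⟩
  rw [nhdsWithin_univ]
  have hs := mem_chart_source (Euc n) p
  have hat := chart_mem_atlas (Euc n) p
  set e := chartAt (Euc n) p
  obtain ⟨C, t, ht, hL⟩ := hX e hat (e.map_source hs)
  rw [e.open_target.nhdsWithin_eq (e.map_source hs)] at ht
  obtain ⟨δ, hδ, hball⟩ := Metric.mem_nhds_iff.1 ht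
  have hnhds : e.source ∩ e ⁻¹' Metric.ball (e p) δ ∈ 𝓝 p :=
    inter_mem (e.open_source.mem_nhds hs)
      ((e.continuousAt hs).preimage_mem_nhds (Metric.ball_mem_nhds _ hδ))
  refine ⟨_, hnhds, ?_⟩
  have hopen : IsOpen (e.source ∩ e ⁻¹' Metric.ball (e p) δ) :=
    e.isOpen_inter_preimage Metric.isOpen_ball
  obtain ⟨K, hK⟩ := (isCompact_closedBall (0 : Fin n → Euc (n + 1)) C).exists_bound_of_continuousOn
    continuous_sqrt_det_gram.continuousOn
  have h1 : inducedVolume X (e.source ∩ e ⁻¹' Metric.ball (e p) δ) =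
      chartVolume X e (e.source ∩ e ⁻¹' Metric.ball (e p) δ) := by
    rw [← inducedVolume_restrict_source X hat, Measure.restrict_apply hopen.measurableSet,
      inter_eq_left.2 inter_subset_left]
  rw [h1, chartVolume_apply X e hopen.measurableSet]
  have hsub : e '' (e.source ∩ e ⁻¹' Metric.ball (e p) δ ∩ e.source) ⊆ Metric.ball (e p) δ := by
    rintro _ ⟨q, ⟨⟨-, hq⟩, -⟩, rfl⟩
    exact hq
  refine lt_of_le_of_lt (lintegral_mono_set hsub) ?_
  refine setLIntegral_lt_top_of_le_nnreal (measure_ball_lt_top.ne)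
    ⟨K.toNNReal, fun u hu => ENNReal.ofReal_le_ofReal ?_⟩
  have hbd : ‖fderiv ℝ (X ∘ e.symm) u‖ ≤ C :=
    norm_fderiv_le_of_lipschitzOn ℝ (Metric.isOpen_ball.mem_nhds hu) (hL.mono hball)
  refine (Real.le_norm_self _).trans (hK _ (mem_closedBall_zero_iff.2 ?_))
  exact (norm_coordDeriv_le (X ∘ e.symm) u).trans hbd

end ChartIntegral

/-! ### The variation integrand as a function on `M` -/

section VariationDensity

open Filter Topology Function

variable {n k : ℕ} {M : Type*} [TopologicalSpace M]

/-- The variation integrand of `Y` in the direction `Z`, in the chart `e`. -/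
noncomputable def chartVariation (Y Z : M → Euc (n + 1)) (e : OpenPartialHomeomorph M (Euc n))
    (u : Euc n) : ℝ :=
  variationForm (volForm (n + 1)) (Y (e.symm u)) (Z (e.symm u)) (chartPartial Y e u)
    (chartPartial Z e u)

theorem chartVariation_eq_zero (Y : M → Euc (n + 1)) {Z : M → Euc (n + 1)}
    {e : OpenPartialHomeomorph M (Euc n)} {u : Euc n} (hu : u ∈ e.target)
    (hZ : e.symm u ∉ tsupport Z) : chartVariation Y Z e u = 0 := by
  have h0 : Z ∘ e.symm =ᶠ[𝓝 u] 0 :=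
    (e.continuousAt_symm hu).eventually (notMem_tsupport_iff_eventuallyEq.1 hZ)
  have h1 : chartPartial Z e u = 0 := by
    funext i
    simp [chartPartial, h0.fderiv_eq]
  rw [chartVariation, h1, show Z (e.symm u) = 0 from h0.eq_of_nhds, variationForm_zero]

theorem variationForm_sum {ι E : Type*} [NormedAddCommGroup E] [NormedSpace ℝ E]
    (D : E [⋀^Fin (n + 1)]→L[ℝ] ℝ) (y : E) (A : Fin n → E) (s : Finset ι) (z : ι → E)
    (B : ι → Fin n → E) :
    variationForm D y (∑ a ∈ s, z a) A (∑ a ∈ s, B a) =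
      ∑ a ∈ s, variationForm D y (z a) A (B a) := by
  classical
  induction s using Finset.induction_on with
  | empty => simp [variationForm_zero]
  | insert a s ha ih =>
    rw [Finset.sum_insert ha, Finset.sum_insert ha, Finset.sum_insert ha, ← ih]
    have h1 : ∀ w, D (Fin.cons w A) = D (update (Fin.cons (0 : E) A) 0 w) := fun w => by
      rw [Fin.update_cons_zero]
    have h2 : ∀ j w, D (Fin.cons y (update A j w)) = D (update (Fin.cons y A) j.succ w) :=
      fun j w => by rw [Fin.cons_update]
    simp only [variationForm, h1, h2, Pi.add_apply, D.map_update_add, Finset.sum_add_distrib]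
    ring

variable [ChartedSpace (Euc n) M]

/-- The density with respect to the volume induced by `X` of the variation integrand of `Y` in the
direction `Z`. -/
noncomputable def variationDensity (X Y Z : M → Euc (n + 1)) (p : M) : ℝ :=
  chartVariation Y Z (chartAt (Euc n) p) (chartAt (Euc n) p p) /
    volumeDensity X (chartAt (Euc n) p) (chartAt (Euc n) p p)

theorem variationDensity_eq_zero (X Y : M → Euc (n + 1)) {Z : M → Euc (n + 1)} {p : M}
    (hp : p ∉ tsupport Z) : variationDensity X Y Z p = 0 := by
  rw [variationDensity, chartVariation_eq_zero Y (mem_chart_target _ p), zero_div]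
  rwa [(chartAt (Euc n) p).left_inv (mem_chart_source _ p)]

/-- `variationDensity` is computed in the preferred chart of each point, which changes from point to
point. Under a coordinate change the numerator is multiplied by `det J` and the denominator by `|det
J|`; these agree because the atlas is oriented. -/
theorem chartVariation_eq_mul [IsManifold (𝓡 n) ∞ M] (hM : IsOrientedAtlas n M)
    (X Y Z : M → Euc (n + 1)) {e : OpenPartialHomeomorph M (Euc n)} (he : e ∈ atlas (Euc n) M)
    {p : M} (hp : p ∈ e.source)
    (h0 : volumeDensity X (chartAt (Euc n) p) (chartAt (Euc n) p p) ≠ 0) :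
    chartVariation Y Z e (e p) = variationDensity X Y Z p * volumeDensity X e (e p) := by
  have hs := mem_chart_source (Euc n) p
  have hat := chart_mem_atlas (Euc n) p
  rw [variationDensity]
  set e₀ := chartAt (Euc n) p
  have hu : e p ∈ (e.symm.trans e₀).source := by
    simp [e.map_source hp, e.left_inv hp, hs]
  have hw : e.symm.trans e₀ (e p) = e₀ p := by simp [e.left_inv hp]
  have hJ := hM e he e₀ hat (e p) hu
  set J := fderiv ℝ (e.symm.trans e₀) (e p)
  have hf : ∀ f : M → Euc (n + 1), fderiv ℝ (f ∘ e.symm) (e p) =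
      (fderiv ℝ (f ∘ e₀.symm) (e₀ p)).comp J := fun f => by
    have := fderiv_comp_symm_transition f hat he hu
    rwa [hw] at this
  have hvol := volumeDensity_eq_of_fderiv X e₀ e (e p) (e₀ p) J (hf X)
  have hpart : ∀ f : M → Euc (n + 1), chartPartial f e (e p) = fun j =>
      (fderiv ℝ (f ∘ e₀.symm) (e₀ p)).toLinearMap (J.toLinearMap (EuclideanSpace.single j 1)) :=
    fun f => by
      funext j
      rw [chartPartial, hf]
      rfl
  have hvar : chartVariation Y Z e (e p) = J.det * chartVariation Y Z e₀ (e₀ p) := by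
    rw [chartVariation, hpart, hpart, variationForm_comp, e.left_inv hp, chartVariation,
      e₀.left_inv hs]
    rfl
  rw [hvol, hvar, abs_of_pos hJ]
  field_simp

theorem variationDensity_sum [IsManifold (𝓡 n) ∞ M] {ι : Type*} (X Y : M → Euc (n + 1))
    (s : Finset ι) {Z : ι → M → Euc (n + 1)} {K : Set M}
    (hZ : ∀ a, ContMDiffOn (𝓡 n) 𝓘(ℝ, Euc (n + 1)) 1 (Z a) K) {p : M} (hp : p ∈ interior K) :
    variationDensity X Y (fun q => ∑ a ∈ s, Z a q) p = ∑ a ∈ s, variationDensity X Y (Z a) p := by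
  have hs := mem_chart_source (Euc n) p
  have hat := chart_mem_atlas (Euc n) p
  simp only [variationDensity, ← Finset.sum_div]
  congr 1
  have h1 : chartPartial (fun q => ∑ a ∈ s, Z a q) (chartAt (Euc n) p) (chartAt (Euc n) p p) =
      ∑ a ∈ s, chartPartial (Z a) (chartAt (Euc n) p) (chartAt (Euc n) p p) := by
    funext j
    have h2 : fderiv ℝ ((fun q => ∑ a ∈ s, Z a q) ∘ (chartAt (Euc n) p).symm)
        (chartAt (Euc n) p p) =
        ∑ a ∈ s, fderiv ℝ (Z a ∘ (chartAt (Euc n) p).symm) (chartAt (Euc n) p p) :=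
      (HasFDerivAt.fun_sum fun a _ =>
        ((hZ a).differentiableAt_comp_symm hat hp hs).hasFDerivAt).fderiv
    rw [chartPartial, h2, Finset.sum_apply]
    simp [chartPartial]
  simp only [chartVariation]
  rw [h1, variationForm_sum]

end VariationDensity

/-! ### The variation formula on the closed manifold -/

section GlobalVariation

open Filter Topology Function

variable {n k : ℕ} {M : Type*} [TopologicalSpace M] [ChartedSpace (Euc n) M] [T2Space M]
  {P : Fin k → Set M}

theorem IsPiecewiseDecomposition.isClosed (hP : IsPiecewiseDecomposition n P) (i : Fin k) :
    IsClosed (P i) :=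
  (hP.domain i).isCompact.isClosed

theorem IsPiecewiseDecomposition.exists_mem_interior (hP : IsPiecewiseDecomposition n P) {p : M}
    (hp : ∀ i, p ∉ frontier (P i)) : ∃ i, p ∈ interior (P i) := by
  obtain ⟨i, hi⟩ := mem_iUnion.1 (hP.cover ▸ mem_univ p : p ∈ ⋃ i, P i)
  refine ⟨i, by_contra fun h => hp i ?_⟩
  rw [(hP.isClosed i).frontier_eq]
  exact ⟨hi, h⟩

variable [IsManifold (𝓡 n) ∞ M] [MeasurableSpace M] [BorelSpace M]

theorem IsPiecewiseDecomposition.ae_chart_notMem_frontier (hP : IsPiecewiseDecomposition n P)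
    (hn : 1 ≤ n) {e : OpenPartialHomeomorph M (Euc n)} (he : e ∈ atlas (Euc n) M) :
    ∀ᵐ u, u ∈ e.target → ∀ i, e.symm u ∉ frontier (P i) := by
  filter_upwards [ae_all_iff.2 fun i => measure_eq_zero_iff_ae_notMem.1
    ((hP.domain i).volume_image_chart_frontier hn he)] with u hu hut i hi
  exact hu i ⟨e.symm u, ⟨hi, e.map_target hut⟩, e.right_inv hut⟩

theorem IsPiecewiseDecomposition.inducedVolume_frontier [CompactSpace M]
    (hP : IsPiecewiseDecomposition n P)
    (hn : 1 ≤ n) (X : M → Euc (n + 1)) (i : Fin k) : inducedVolume X (frontier (P i)) = 0 :=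
  inducedVolume_eq_zero X isClosed_frontier.measurableSet fun _ he =>
    (hP.domain i).volume_image_chart_frontier hn he

theorem IsPiecewiseDecomposition.ae_notMem_frontier [CompactSpace M]
    (hP : IsPiecewiseDecomposition n P)
    (hn : 1 ≤ n) (X : M → Euc (n + 1)) : ∀ᵐ p ∂(inducedVolume X), ∀ i, p ∉ frontier (P i) :=
  ae_all_iff.2 fun i => measure_eq_zero_iff_ae_notMem.1 (hP.inducedVolume_frontier hn X i)

theorem IsPiecewiseDecomposition.integral_eq_sum [CompactSpace M]
    (hP : IsPiecewiseDecomposition n P) (hn : 1 ≤ n)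
    (X : M → Euc (n + 1)) {g : M → ℝ} (hg : Integrable g (inducedVolume X)) :
    ∫ p, g p ∂(inducedVolume X) = ∑ i, ∫ p in P i, g p ∂(inducedVolume X) := by
  have h := integral_iUnion_ae (μ := inducedVolume X) (f := g) (s := P)
    (fun i => (hP.isClosed i).measurableSet.nullMeasurableSet)
    (fun i j hij => measure_mono_null (t := frontier (P i)) (by
      rw [hP.inter i j hij]
      exact inter_subset_left) (hP.inducedVolume_frontier hn X i)) hg.integrableOn
  rw [hP.cover, setIntegral_univ, tsum_fintype] at h
  exact h

variable {X : M → Euc (n + 1)} {ν : Fin k → M → USphere n}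

/-- The integrand vanishes off the support of `Z`, so `Y` matters only near it. After a cutoff both
maps extend to compactly supported Lipschitz maps on `ℝⁿ`. -/
theorem integral_variationDensity_of_tsupport_subset [CompactSpace M]
    (hn : 1 ≤ n) (hM : IsOrientedAtlas n M)
    (hP : IsPiecewiseDecomposition n P) (hX : IsPiecewiseWeakImmersion 2 P X ν)
    {Y Z : M → Euc (n + 1)} (hY : ∀ i, ContMDiffOn (𝓡 n) 𝓘(ℝ, Euc (n + 1)) 1 Y (P i))
    (hZ : ∀ i, ContMDiffOn (𝓡 n) 𝓘(ℝ, Euc (n + 1)) 1 Z (P i))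
    {e : OpenPartialHomeomorph M (Euc n)} (he : e ∈ atlas (Euc n) M)
    (hs : tsupport Z ⊆ e.source) :
    Integrable (variationDensity X Y Z) (inducedVolume X) ∧
      ∫ p, variationDensity X Y Z p ∂(inducedVolume X) = 0 := by
  -- The cutoff `χ` must be `1` near the support of `Z`, so that derivatives of `χ • Y` and `Y`
  -- agree there, and its support must stay inside the chart domain.
  obtain ⟨V, hVo, hZV, hVe⟩ := normal_exists_closure_subset (isClosed_tsupport Z) e.open_source hs
  obtain ⟨χ, hχ1, hχ0, -⟩ := exists_contMDiffMap_one_nhds_of_subset_interior (𝓡 n) (n := 1)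
    (isClosed_tsupport Z) (hZV.trans (hVo.subset_interior_iff.2 subset_closure))
  have hχs : tsupport (fun q => χ q • Y q) ⊆ e.source := by
    refine (closure_minimal (fun q hq => ?_) isClosed_closure).trans hVe
    by_contra h
    exact hq (by simp [hχ0 q h])
  have hχY : ∀ i, ContMDiffOn (𝓡 n) 𝓘(ℝ, Euc (n + 1)) 1 (fun q => χ q • Y q) (P i) := fun i =>
    (χ.contMDiff.contMDiffOn).smul (hY i)
  obtain ⟨hyc, -, C, hyL⟩ :=
    exists_lipschitzWith_chartExtension hP.isClosed hP.cover hχY he hχs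
  obtain ⟨hzc, hzt, C', hzL⟩ :=
    exists_lipschitzWith_chartExtension hP.isClosed hP.cover hZ he hs
  set y := chartExtension e (fun q => χ q • Y q)
  set z := chartExtension e Z
  have hint := integrable_variationForm (volForm (n + 1)) hyL hzL hyc hzc
  have hzero := integral_variationForm_of_lipschitzWith (volForm (n + 1)) hyL hzL hyc hzc
  have hchart : ∀ u ∈ e.target, variationForm (volForm (n + 1)) (y u) (z u) (coordDeriv y u)
      (coordDeriv z u) = chartVariation Y Z e u := by
    intro u hu
    have hz : z =ᶠ[𝓝 u] Z ∘ e.symm := chartExtension_eventuallyEq e Z hu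
    by_cases hZu : e.symm u ∈ tsupport Z
    · have hy : y =ᶠ[𝓝 u] Y ∘ e.symm := by
        filter_upwards [chartExtension_eventuallyEq e (fun q => χ q • Y q) hu,
          (e.continuousAt_symm hu).eventually (hχ1.filter_mono (nhds_le_nhdsSet hZu))] with v h1 h2
        rw [show y v = _ from h1, comp_apply, comp_apply, h2, one_smul]
      have hdy : coordDeriv y u = chartPartial Y e u := by
        funext j
        rw [coordDeriv, hy.fderiv_eq, chartPartial]
      have hdz : coordDeriv z u = chartPartial Z e u := by
        funext j
        rw [coordDeriv, hz.fderiv_eq, chartPartial]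
      rw [hdy, hdz, hy.eq_of_nhds, hz.eq_of_nhds, chartVariation]
      rfl
    · rw [chartVariation_eq_zero Y hu hZu]
      refine variationForm_eq_zero_of_notMem_tsupport _ (notMem_tsupport_iff_eventuallyEq.2 ?_)
      filter_upwards [hz, (e.continuousAt_symm hu).eventually
        (notMem_tsupport_iff_eventuallyEq.1 hZu)] with v h1 h2
      rw [show z v = _ from h1, comp_apply, h2]
      rfl
  have hmul : ∀ᵐ u, u ∈ e.target → variationForm (volForm (n + 1)) (y u) (z u) (coordDeriv y u)
      (coordDeriv z u) = variationDensity X Y Z (e.symm u) * volumeDensity X e u := by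
    filter_upwards [hP.ae_chart_notMem_frontier hn he] with u hu hut
    obtain ⟨i, hi⟩ := hP.exists_mem_interior (hu hut)
    rw [hchart u hut]
    have := chartVariation_eq_mul hM X Y Z he (e.map_target hut)
      (hX.volumeDensity_chartAt hi).2.ne'
    rwa [e.right_inv hut] at this
  obtain ⟨h1, h2⟩ := setIntegral_source_inducedVolume X he hint hmul
  have hsupp : ∀ p ∉ e.source, variationDensity X Y Z p = 0 := fun p hp =>
    variationDensity_eq_zero X Y fun h => hp (hs h)
  constructor
  · refine (integrableOn_iff_integrable_of_support_subset fun p hp => ?_).1 h1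
    by_contra h
    exact hp (hsupp p h)
  · rw [← setIntegral_eq_integral_of_forall_compl_eq_zero hsupp, h2,
      setIntegral_eq_integral_of_forall_compl_eq_zero, hzero]
    exact fun u hu => variationForm_eq_zero_of_notMem_tsupport _ fun h => hu (hzt h)

/-- The integrand is linear in `Z` but not in `Y`, so only `Z` is cut up by the partition of unity.
-/
theorem integral_variationDensity [CompactSpace M]
    (hn : 1 ≤ n) (hM : IsOrientedAtlas n M)
    (hP : IsPiecewiseDecomposition n P) (hX : IsPiecewiseWeakImmersion 2 P X ν)
    {Y Z : M → Euc (n + 1)} (hY : ∀ i, ContMDiffOn (𝓡 n) 𝓘(ℝ, Euc (n + 1)) 1 Y (P i))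
    (hZ : ∀ i, ContMDiffOn (𝓡 n) 𝓘(ℝ, Euc (n + 1)) 1 Z (P i)) :
    Integrable (variationDensity X Y Z) (inducedVolume X) ∧
      ∫ p, variationDensity X Y Z p ∂(inducedVolume X) = 0 := by
  obtain ⟨ρ, hρ⟩ := SmoothPartitionOfUnity.exists_isSubordinate_chartAt_source (𝓡 n) M
  have hfin := ρ.locallyFinite.finite_nonempty_of_compact
  have hsum : ∀ q, Z q = ∑ a ∈ hfin.toFinset, ρ a q • Z q := by
    intro q
    rw [← Finset.sum_smul, ← finsum_eq_sum_of_support_subset, ρ.sum_eq_one (mem_univ q), one_smul]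
    intro a ha
    rw [Finite.coe_toFinset]
    exact ⟨q, ha⟩
  have hρZ : ∀ a i, ContMDiffOn (𝓡 n) 𝓘(ℝ, Euc (n + 1)) 1 (fun q => ρ a q • Z q) (P i) :=
    fun a i => (((ρ a).contMDiff.of_le (by simp)).contMDiffOn).smul (hZ i)
  have hpiece : ∀ a, Integrable (variationDensity X Y fun q => ρ a q • Z q) (inducedVolume X) ∧
      ∫ p, variationDensity X Y (fun q => ρ a q • Z q) p ∂(inducedVolume X) = 0 := fun a =>
    integral_variationDensity_of_tsupport_subset hn hM hP hX hY (hρZ a) (chart_mem_atlas _ a)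
      ((tsupport_smul_subset_left _ _).trans (hρ a))
  have hae : variationDensity X Y Z =ᵐ[inducedVolume X] fun p =>
      ∑ a ∈ hfin.toFinset, variationDensity X Y (fun q => ρ a q • Z q) p := by
    filter_upwards [hP.ae_notMem_frontier hn X] with p hp
    obtain ⟨i, hi⟩ := hP.exists_mem_interior hp
    rw [← variationDensity_sum X Y hfin.toFinset (fun a => hρZ a i) hi, ← funext hsum]
  constructor
  · exact (integrable_congr hae).2 (integrable_finsetSum _ fun a _ => (hpiece a).1)
  · rw [integral_congr_ae hae, integral_finsetSum _ fun a _ => (hpiece a).1]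
    exact Finset.sum_eq_zero fun a _ => (hpiece a).2

end GlobalVariation

/-! ### Comparison of coefficients and the Minkowski formula -/

section Minkowski

open Filter Topology Function

theorem anisotropicMeanCurvature_zero {n : ℕ} {M : Type*} [TopologicalSpace M]
    [ChartedSpace (Euc n) M] (γ : USphere n → ℝ) (X : M → Euc (n + 1)) (ν : M → USphere n) (p : M) :
    anisotropicMeanCurvature γ X ν 0 p = 1 := by
  simp [anisotropicMeanCurvature, Multiset.esymm]

/-- The polynomial with coefficients `a r` has every nonzero real as a root. -/
theorem eq_zero_of_forall_sum_pow_eq_zero {n : ℕ} {a : ℕ → ℝ}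
    (h : ∀ t : ℝ, t ≠ 0 → ∑ r ∈ Finset.range n, (-t) ^ r * a r = 0) : ∀ r < n, a r = 0 := by
  let q : Polynomial ℝ := ∑ r ∈ Finset.range n, Polynomial.C (a r) * Polynomial.X ^ r
  have hq : q = 0 := by
    refine Polynomial.eq_zero_of_infinite_isRoot q
      ((finite_singleton (0 : ℝ)).infinite_compl.mono fun s hs => ?_)
    have := h (-s) (neg_ne_zero.2 hs)
    simp only [neg_neg] at this
    simp only [mem_ofPred_eq, Polynomial.IsRoot, q, Polynomial.eval_finsetSum, Polynomial.eval_mul,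
      Polynomial.eval_C, Polynomial.eval_pow, Polynomial.eval_X]
    rw [← this]
    exact Finset.sum_congr rfl fun r _ => mul_comm _ _
  intro r hr
  have h1 := congrArg (fun f => Polynomial.coeff f r) hq
  simpa [q, Polynomial.finsetSum_coeff, Polynomial.coeff_C_mul, Polynomial.coeff_X_pow, hr]
    using h1

/-- Distinct pieces meet only in their boundaries, where the fields agree, so any choice of a piece
at each point gives the same field. This is where the edge condition enters; the normals themselves
may jump. -/
theorem exists_global_cahnHoffmanField {n k : ℕ} {M : Type*} [TopologicalSpace M]
    [ChartedSpace (Euc n) M] {P : Fin k → Set M} {ν : Fin k → M → USphere n}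
    (hP : IsPiecewiseDecomposition n P) {γ : USphere n → ℝ}
    (hedge : ∀ i j, ∀ ζ ∈ frontier (P i) ∩ frontier (P j),
      cahnHoffmanField γ (ν i) ζ = cahnHoffmanField γ (ν j) ζ) :
    ∃ Ξ : M → Euc (n + 1), ∀ i, ∀ p ∈ P i, Ξ p = cahnHoffmanField γ (ν i) p := by
  have hc : ∀ p, ∃ i, p ∈ P i := fun p => mem_iUnion.1 (hP.cover ▸ mem_univ p : p ∈ ⋃ i, P i)
  choose idx hidx using hc
  refine ⟨fun p => cahnHoffmanField γ (ν (idx p)) p, fun i p hp => ?_⟩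
  rcases eq_or_ne (idx p) i with h | h
  · subst h
    rfl
  · exact hedge _ _ p (hP.inter _ _ h ▸ ⟨hidx p, hp⟩)

variable {n k : ℕ} {M : Type*} [TopologicalSpace M] [CompactSpace M] [ChartedSpace (Euc n) M]
  [T2Space M] [IsManifold (𝓡 n) ∞ M] [MeasurableSpace M] [BorelSpace M] {P : Fin k → Set M}
  {X : M → Euc (n + 1)} {ν : Fin k → M → USphere n}

theorem integrableOn_minkowski (hP : IsPiecewiseDecomposition n P)
    (hX : IsPiecewiseWeakImmersion 2 P X ν) {γ : USphere n → ℝ} (hγ : Continuous γ)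
    (hint : ∀ r, 1 ≤ r → r ≤ n → ∀ i,
      IntegrableOn (anisotropicMeanCurvature γ X (ν i) r) (P i) (inducedVolume X))
    {r : ℕ} (hr : r < n) (i : Fin k) :
    IntegrableOn (fun p => γ (ν i p) * anisotropicMeanCurvature γ X (ν i) r p +
      inner ℝ (X p) (ν i p : Euc (n + 1)) * anisotropicMeanCurvature γ X (ν i) (r + 1) p)
      (P i) (inducedVolume X) := by
  have hfin : IsFiniteMeasure (inducedVolume X) := isFiniteMeasure_inducedVolume fun e he =>
    locallyLipschitzOn_comp_symm hP.isClosed hP.cover hX.contMDiffOn_one he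
  have hm := (hP.isClosed i).measurableSet
  have hν : ContinuousOn (ν i) (P i) := (hX.normal_contMDiffOn_one i).continuousOn
  have hH : IntegrableOn (anisotropicMeanCurvature γ X (ν i) r) (P i) (inducedVolume X) := by
    -- The case `r = 0` is not covered by `hint`: `H₀ = 1` is integrable because the area is finite.
    rcases Nat.eq_zero_or_pos r with rfl | hr0
    · rw [show anisotropicMeanCurvature γ X (ν i) 0 = fun _ => 1 from
        funext fun p => anisotropicMeanCurvature_zero γ X (ν i) p]
      exact integrableOn_const (measure_ne_top _ _)
    · exact hint r hr0 hr.le i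
  obtain ⟨C, hC⟩ := isCompact_univ.exists_bound_of_continuousOn (f := γ) hγ.continuousOn
  obtain ⟨C', hC'⟩ := isCompact_univ.exists_bound_of_continuousOn (f := X)
    hX.continuous.continuousOn
  refine Integrable.add (hH.bdd_mul (c := C) ?_ ?_) ((hint (r + 1) (by omega) hr i).bdd_mul (c := C') ?_ ?_)
  · exact (hγ.comp_continuousOn hν).aestronglyMeasurable hm
  · exact Eventually.of_forall fun p => hC _ (mem_univ _)
  · exact (hX.continuous.continuousOn.inner
      (continuous_subtype_val.comp_continuousOn hν)).aestronglyMeasurable hm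
  · refine Eventually.of_forall fun p => (norm_inner_le_norm _ _).trans ?_
    rw [norm_eq_of_mem_sphere (ν i p), mul_one]
    exact hC' p (mem_univ p)

theorem sum_setIntegral_minkowski (hn : 1 ≤ n) (hM : IsOrientedAtlas n M)
    (hP : IsPiecewiseDecomposition n P) (hX : IsPiecewiseWeakImmersion 2 P X ν) {γ : USphere n → ℝ}
    (hγ : ContMDiff (𝓡 n) 𝓘(ℝ, ℝ) 2 γ)
    (hint : ∀ r, 1 ≤ r → r ≤ n → ∀ i,
      IntegrableOn (anisotropicMeanCurvature γ X (ν i) r) (P i) (inducedVolume X))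
    (hedge : ∀ i j, ∀ ζ ∈ frontier (P i) ∩ frontier (P j),
      cahnHoffmanField γ (ν i) ζ = cahnHoffmanField γ (ν j) ζ) {r : ℕ} (hr : r < n) :
    ∑ i, ∫ p in P i, (γ (ν i p) * anisotropicMeanCurvature γ X (ν i) r p +
      inner ℝ (X p) (ν i p : Euc (n + 1)) * anisotropicMeanCurvature γ X (ν i) (r + 1) p)
      ∂(inducedVolume X) = 0 := by
  obtain ⟨Ξ, hΞ⟩ := exists_global_cahnHoffmanField hP hedge
  let f : ℕ → Fin k → M → ℝ := fun r i p =>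
    γ (ν i p) * anisotropicMeanCurvature γ X (ν i) r p +
      inner ℝ (X p) (ν i p : Euc (n + 1)) * anisotropicMeanCurvature γ X (ν i) (r + 1) p
  have hf : ∀ r < n, ∀ i, IntegrableOn (f r i) (P i) (inducedVolume X) := fun r hr i =>
    integrableOn_minkowski hP hX hγ.continuous hint hr i
  have hΞ1 : ∀ i, ContMDiffOn (𝓡 n) 𝓘(ℝ, Euc (n + 1)) 1 Ξ (P i) := fun i =>
    (contMDiffOn_cahnHoffmanField hγ (hX.normal_contMDiffOn_one i)).congr (hΞ i)
  have hYt : ∀ (t : ℝ) i, ContMDiffOn (𝓡 n) 𝓘(ℝ, Euc (n + 1)) 1 (fun q => X q + t • Ξ q) (P i) :=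
    fun t i => (hX.contMDiffOn_one i).add
      ((contMDiffOn_const : ContMDiffOn (𝓡 n) 𝓘(ℝ, ℝ) 1 (fun _ => t) (P i)).smul (hΞ1 i))
  have hsum : ∀ t : ℝ, t ≠ 0 → ∑ r ∈ Finset.range n, (-t) ^ r *
      (((n - r : ℕ) * n.choose r) * ∑ i, ∫ p in P i, f r i p ∂(inducedVolume X)) = 0 := by
    intro t ht
    -- The parallel map `X + t Ξ` is varied in the direction of the position vector `X`.
    obtain ⟨h1, h2⟩ := integral_variationDensity hn hM hP hX
      (Y := fun q => X q + t • Ξ q) (Z := X)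
      (hYt t) hX.contMDiffOn_one
    have h3 : ∀ i, ∫ p in P i, variationDensity X (fun q => X q + t • Ξ q) X p ∂(inducedVolume X) =
        -t * ∑ r ∈ Finset.range n, (-t) ^ r * ((n - r : ℕ) * n.choose r) *
          ∫ p in P i, f r i p ∂(inducedVolume X) := by
      intro i
      have h4 : variationDensity X (fun q => X q + t • Ξ q) X =ᵐ[(inducedVolume X).restrict (P i)]
          fun p => -t * ∑ r ∈ Finset.range n, (-t) ^ r * ((n - r : ℕ) * n.choose r) * f r i p := by
        filter_upwards [ae_restrict_of_ae (hP.ae_notMem_frontier hn X),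
          ae_restrict_mem (hP.isClosed i).measurableSet] with p hp hpi
        have hpint : p ∈ interior (P i) := by
          by_contra h
          exact hp i ((hP.isClosed i).frontier_eq ▸ ⟨hpi, h⟩)
        have hev : Ξ =ᶠ[𝓝 p] cahnHoffmanField γ (ν i) := by
          filter_upwards [mem_interior_iff_mem_nhds.1 hpint] with q hq using hΞ i q hq
        rw [variationDensity, chartVariation,
          (chartAt (Euc n) p).left_inv (mem_chart_source _ p),
          hX.variationForm_chartAt hγ hpint hev ht,
          mul_div_cancel_right₀ _ (hX.volumeDensity_chartAt hpint).2.ne']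
      -- `h1` controls only the whole sum over `r`; separating the powers of `t` uses the
      -- integrability of each term, which rests on `hint`.
      rw [integral_congr_ae h4, integral_const_mul, integral_finsetSum]
      · simp only [integral_const_mul]
      · exact fun r hr => (hf r (Finset.mem_range.1 hr) i).const_mul _
    rw [hP.integral_eq_sum hn X h1, Finset.sum_congr rfl fun i _ => h3 i, ← Finset.mul_sum,
      Finset.sum_comm] at h2
    rw [← (mul_eq_zero.1 h2).resolve_left (neg_ne_zero.2 ht)]
    refine Finset.sum_congr rfl fun r _ => ?_
    rw [← Finset.mul_sum, mul_assoc ((-t) ^ r)]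
  have h0 := eq_zero_of_forall_sum_pow_eq_zero hsum r hr
  refine (mul_eq_zero.1 h0).resolve_left (mul_ne_zero ?_ ?_)
  · exact_mod_cast (Nat.sub_pos_of_lt hr).ne'
  · exact_mod_cast (Nat.choose_pos hr.le).ne'

end Minkowski

theorem theorem11p1 {n k : ℕ} (hn : 1 ≤ n)
    -- the closed oriented manifold `M`
    {M : Type*} [TopologicalSpace M] [T2Space M] [CompactSpace M] [ConnectedSpace M]
    [ChartedSpace (Euc n) M] [IsManifold (𝓡 n) ∞ M] (hM : IsOrientedAtlas n M)
    [MeasurableSpace M] [BorelSpace M]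
    -- the energy density
    (γ : USphere n → ℝ) (hγ_pos : ∀ w, 0 < γ w) (hγ : ContMDiff (𝓡 n) 𝓘(ℝ, ℝ) 2 γ)
    -- the piecewise-`C²` weak immersion
    (P : Fin k → Set M) (hP : IsPiecewiseDecomposition n P)
    (X : M → Euc (n + 1)) (ν : Fin k → M → USphere n) (hX : IsPiecewiseWeakImmersion 2 P X ν)
    -- the anisotropic mean curvatures are integrable
    (hint : ∀ r, 1 ≤ r → r ≤ n → ∀ i,
      IntegrableOn (anisotropicMeanCurvature γ X (ν i) r) (P i) (inducedVolume X))
    -- the Cahn–Hoffman fields agree along common edges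
    (hedge : ∀ i j, ∀ ζ ∈ frontier (P i) ∩ frontier (P j),
      cahnHoffmanField γ (ν i) ζ = cahnHoffmanField γ (ν j) ζ) :
    (∀ r < n,
      (∀ i, IntegrableOn (fun p => γ (ν i p) * anisotropicMeanCurvature γ X (ν i) r p +
          inner ℝ (X p) (ν i p : Euc (n + 1)) * anisotropicMeanCurvature γ X (ν i) (r + 1) p)
        (P i) (inducedVolume X)) ∧
      ∑ i, ∫ p in P i, (γ (ν i p) * anisotropicMeanCurvature γ X (ν i) r p +
          inner ℝ (X p) (ν i p : Euc (n + 1)) * anisotropicMeanCurvature γ X (ν i) (r + 1) p)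
        ∂(inducedVolume X) = 0) ∧
    ∑ i, ∫ p in P i, (γ (ν i p) +
          anisotropicMeanCurvature γ X (ν i) 1 p * inner ℝ (X p) (ν i p : Euc (n + 1)))
        ∂(inducedVolume X) = 0 := by

  have h := fun r (hr : r < n) => sum_setIntegral_minkowski hn hM hP hX hγ hint hedge hr
  refine ⟨fun r hr => ⟨fun i => integrableOn_minkowski hP hX hγ.continuous hint hr i, h r hr⟩, ?_⟩
  have h0 := h 0 (by omega)
  simp only [anisotropicMeanCurvature_zero, mul_one, zero_add] at h0
  simpa only [mul_comm] using h0
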